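/- Let $X$ be a projective variety over a number field $K$ (an integral proper $K$-scheme carrying an ample class), and let $\mathcal L\in \mathrm{Pic}(X)\otimes\mathbb R$ be ample. We represent $\mathcal L$ by an $\mathcal O_X^\times\otimes_{\mathbb Z}\mathbb R$-cocycle; isomorphisms of such "real line bundles" are taken in the same sense, and exist exactly when the classes in $\mathrm{Pic}(X)\otimes\mathbb R$ are equal. Let $\varphi,\psi:X\to X$ be $K$-morphisms, $\alpha,\beta>1$ real numbers, and $\Phi:\mathcal L^{\alpha}\xrightarrow{\sim}\varphi^*\mathcal L$, $\Psi:\mathcal L^{\beta}\xrightarrow{\sim}\psi^*\mathcal L$ isomorphisms, so that $(X,\varphi,\mathcal L,\alpha)$ and $(X,\psi,\mathcal L,\beta)$ are polarized dynamical systems. Assume $\varphi\circ\psi=\psi\circ\varphi$. For a place $v$ of $K$, a metric on $\mathcal L_v$ is a family of norms on the fibres of $\mathcal L$ at the points of $X(\overline K_v)$. It is called continuous if the norms of local frames are continuous for the $v$-adic topology, and bounded if the logarithms of the norms of local frames are bounded on bounded subsets of affine open sets contained in the domain of the frame. A continuous and bounded metric $\|\cdot\|_{v,\varphi}$ is called the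 canonical metric of $(X,\varphi,\mathcal L,\alpha)$ at $v$, relative to $\Phi$, if for every continuous and bounded metric $\|\cdot\|_{v,1}$ on $\mathcal L_v$ the sequence $\|\cdot\|_{v,n}=(\Phi^*\varphi^*\|\cdot\|_{v,n-1})^{1/\alpha}$ ($n>1$) converges uniformly on $X(\overline K_v)$ to $\|\cdot\|_{v,\varphi}$ (that is, the logarithm of the quotient of the two metrics converges uniformly to $0$). Similarly for $\|\cdot\|_{v,\psi}$, with $\psi$, $\Psi$ and $\beta$. Call $\Phi$ and $\Psi$ compatible if the two isomorphisms $\mathcal L^{\alpha\beta}\xrightarrow{\sim}(\varphi\circ\psi)^*\mathcal L=(\psi\circ\varphi)^*\mathcal L$ given by $\psi^*\Phi\circ\Psi^{\otimes\alpha}$ and $\varphi^*\Psi\circ\Phi^{\otimes\beta}$ coincide. Then: 1. At every place $v$ of $K$ the canonical metrics $\|\cdot\|_{v,\varphi}$ and $\|\cdot\|_{v,\psi}$ exist and are unique. 2. If $\Phi$ and $\Psi$ are compatible, then $\|\cdot\|_{v,\varphi}=\|\cdot\|_{v,\psi}$ at every place $v$ of $K$. 3. Given $\Phi$, there is always an isomorphism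 $\Psi':\mathcal L^{\beta}\xrightarrow{\sim}\psi^*\mathcal L$ compatible with $\Phi$. 4. For arbitrary $\Phi$ and $\Psi$ there is a single $c\in\Gamma(X,\mathcal O_X^\times)\otimes_{\mathbb Z}\mathbb R$ such that $\|\cdot\|_{v,\psi}=|c|_v\,\|\cdot\|_{v,\varphi}$ on $X(\overline K_v)$ for all places $v$ of $K$ simultaneously. -/

import Mathlib

open CategoryTheory AlgebraicGeometry NumberField IsDedekindDomain TopologicalSpace
open scoped TensorProduct

universe u

noncomputable section

namespace PolDyn

/-! ### Units with real exponents -/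

/-- `𝒪(U)ˣ ⊗ ℝ`, written additively: the real vector space of formal products `∏ fₖ ^ rₖ` of
invertible functions on `U` with real exponents. -/
abbrev RUnits (X : Scheme.{u}) (U : X.Opens) : Type u := ℝ ⊗[ℤ] Additive Γ(X, U)ˣ

/-- The linear map `𝒪(U)ˣ ⊗ ℝ → 𝒪(V)ˣ ⊗ ℝ` induced by a ring homomorphism. -/
def RUnits.ofHom {X Y : Scheme.{u}} {U : X.Opens} {V : Y.Opens} (f : Γ(X, U) ⟶ Γ(Y, V)) :
    RUnits X U →ₗ[ℝ] RUnits Y V :=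
  LinearMap.baseChange ℝ
    (MonoidHom.toAdditive (Units.map (f.hom : Γ(X, U) →* Γ(Y, V)))).toIntLinearMap

/-- Restriction to a smaller open set. -/
def RUnits.res {X : Scheme.{u}} {U V : X.Opens} (e : V ≤ U) : RUnits X U →ₗ[ℝ] RUnits X V :=
  RUnits.ofHom (X.presheaf.map (homOfLE e).op)

/-- Pullback along a morphism `f`, restricted to an open subset `V` of the preimage. -/
def RUnits.pull {X Y : Scheme.{u}} (f : Y ⟶ X) {U : X.Opens} {V : Y.Opens} (e : V ≤ f ⁻¹ᵁ U) :
    RUnits X U →ₗ[ℝ] RUnits Y V :=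
  RUnits.ofHom (f.appLE U V e)

theorem RUnits.ofHom_comp {X Y Z : Scheme.{u}} {U : X.Opens} {V : Y.Opens} {W : Z.Opens}
    (f : Γ(X, U) ⟶ Γ(Y, V)) (g : Γ(Y, V) ⟶ Γ(Z, W)) (a : RUnits X U) :
    RUnits.ofHom g (RUnits.ofHom f a) = RUnits.ofHom (f ≫ g) a := by
  unfold RUnits.ofHom
  induction a using TensorProduct.induction_on with
  | zero => simp
  | tmul r m => rfl
  | add x y hx hy => simp only [map_add, hx, hy]

theorem RUnits.res_res {X : Scheme.{u}} {U V W : X.Opens} (e : V ≤ U) (e' : W ≤ V)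
    (a : RUnits X U) : RUnits.res e' (RUnits.res e a) = RUnits.res (e'.trans e) a := by
  unfold RUnits.res
  rw [RUnits.ofHom_comp, ← Functor.map_comp]
  rfl

theorem RUnits.res_pull {X Y : Scheme.{u}} (f : Y ⟶ X) {U : X.Opens} {V W : Y.Opens}
    (e : V ≤ f ⁻¹ᵁ U) (e' : W ≤ V) (a : RUnits X U) :
    RUnits.res e' (RUnits.pull f e a) = RUnits.pull f (e'.trans e) a := by
  unfold RUnits.res RUnits.pull
  rw [RUnits.ofHom_comp, Scheme.Hom.appLE_map]

theorem RUnits.pull_res {X Y : Scheme.{u}} (f : Y ⟶ X) {U U' : X.Opens} {V : Y.Opens}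
    (e : U' ≤ U) (e' : V ≤ f ⁻¹ᵁ U') (e'' : V ≤ f ⁻¹ᵁ U) (a : RUnits X U) :
    RUnits.pull f e' (RUnits.res e a) = RUnits.pull f e'' a := by
  unfold RUnits.res RUnits.pull
  rw [RUnits.ofHom_comp, Scheme.Hom.map_appLE]

/-! ### Line bundles, ampleness, real line bundles -/

/-- A line bundle on `X`, given by local frames `e i` on an open cover `U i` and transition
functions `g i j` with `e j = g i j * e i` on `U i ∩ U j`. -/
structure LineBundle (X : Scheme.{u}) where
  ι : Type
  U : ι → X.Opens
  cover : ∀ t : X, ∃ i, t ∈ U i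
  g : ∀ i j, Γ(X, U i ⊓ U j)ˣ
  cocycle : ∀ (i j k : ι) (W : X.Opens) (hij : W ≤ U i ⊓ U j) (hjk : W ≤ U j ⊓ U k)
    (hik : W ≤ U i ⊓ U k),
    X.presheaf.map (homOfLE hij).op (g i j).1 * X.presheaf.map (homOfLE hjk).op (g j k).1 =
      X.presheaf.map (homOfLE hik).op (g i k).1

/-- Global sections of the tensor power `M ^ n`: local coefficients `s i` with respect to the
frames `(e i) ^ n`, so that `s i = (g i j) ^ n * s j` on overlaps. -/
structure LineBundle.PowSection {X : Scheme.{u}} (M : LineBundle X) (n : ℕ) where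
  coeff : ∀ i, Γ(X, M.U i)
  glue : ∀ i j, X.presheaf.map (homOfLE (inf_le_left : M.U i ⊓ M.U j ≤ M.U i)).op (coeff i) =
    (M.g i j).1 ^ n *
      X.presheaf.map (homOfLE (inf_le_right : M.U i ⊓ M.U j ≤ M.U j)).op (coeff j)

/-- The open set `X_s` where the section `s` does not vanish. -/
def LineBundle.PowSection.locus {X : Scheme.{u}} {M : LineBundle X} {n : ℕ}
    (s : M.PowSection n) : X.Opens :=
  ⨆ i, X.basicOpen (s.coeff i)

/-- A line bundle on a quasi-compact scheme is ample if every point has an affine neighbourhood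
of the form `X_s`, with `s` a global section of a positive power. -/
def LineBundle.IsAmple {X : Scheme.{u}} (M : LineBundle X) : Prop :=
  CompactSpace X ∧
    ∀ t : X, ∃ n : ℕ, 0 < n ∧ ∃ s : M.PowSection n, t ∈ s.locus ∧ IsAffineOpen s.locus

/-- A real line bundle, representing an element of `Pic(X) ⊗ ℝ`: a cocycle with values in the
units with real exponents (a torsor under `𝒪ˣ ⊗ ℝ`). It has formal local frames `e i` on `U i`
with `e j = g i j * e i` on overlaps (the group of units is written additively). -/
structure RLineBundle (X : Scheme.{u}) where
  ι : Type
  U : ι → X.Opens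
  cover : ∀ t : X, ∃ i, t ∈ U i
  g : ∀ i j, RUnits X (U i ⊓ U j)
  cocycle : ∀ (i j k : ι) (W : X.Opens) (hij : W ≤ U i ⊓ U j) (hjk : W ≤ U j ⊓ U k)
    (hik : W ≤ U i ⊓ U k),
    RUnits.res hij (g i j) + RUnits.res hjk (g j k) = RUnits.res hik (g i k)

/-- The real line bundle defined by a line bundle. -/
def LineBundle.toReal {X : Scheme.{u}} (M : LineBundle X) : RLineBundle X where
  ι := M.ι
  U := M.U
  cover := M.cover
  g i j := (1 : ℝ) ⊗ₜ Additive.ofMul (M.g i j)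
  cocycle i j k W hij hjk hik := by
    simp only [RUnits.res, RUnits.ofHom, LinearMap.baseChange_tmul, ← TensorProduct.tmul_add]
    congr 1
    apply Additive.toMul.injective
    apply Units.ext
    exact M.cocycle i j k W hij hjk hik

namespace RLineBundle

variable {X Y : Scheme.{u}}

/-- The real power `L ^ r`, with frames `(e i) ^ r`. -/
abbrev pow (L : RLineBundle X) (r : ℝ) : RLineBundle X where
  ι := L.ι
  U := L.U
  cover := L.cover
  g i j := r • L.g i j
  cocycle i j k W hij hjk hik := by
    simp only [map_smul, ← smul_add]
    rw [L.cocycle i j k W hij hjk hik]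

/-- The tensor product, with frames `e i ⊗ e' i'` on `U i ∩ U' i'`. -/
def tensor (L M : RLineBundle X) : RLineBundle X where
  ι := L.ι × M.ι
  U i := L.U i.1 ⊓ M.U i.2
  cover t := by
    obtain ⟨i, hi⟩ := L.cover t
    obtain ⟨j, hj⟩ := M.cover t
    exact ⟨(i, j), hi, hj⟩
  g i j := RUnits.res (inf_le_inf inf_le_left inf_le_left) (L.g i.1 j.1) +
    RUnits.res (inf_le_inf inf_le_right inf_le_right) (M.g i.2 j.2)
  cocycle i j k W hij hjk hik := by
    simp only [map_add, RUnits.res_res]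
    rw [← L.cocycle i.1 j.1 k.1 W (hij.trans (inf_le_inf inf_le_left inf_le_left))
      (hjk.trans (inf_le_inf inf_le_left inf_le_left))
      (hik.trans (inf_le_inf inf_le_left inf_le_left)),
      ← M.cocycle i.2 j.2 k.2 W (hij.trans (inf_le_inf inf_le_right inf_le_right))
      (hjk.trans (inf_le_inf inf_le_right inf_le_right))
      (hik.trans (inf_le_inf inf_le_right inf_le_right))]
    abel

theorem preimage_inf_le (f : Y ⟶ X) (U V : X.Opens) : f ⁻¹ᵁ U ⊓ f ⁻¹ᵁ V ≤ f ⁻¹ᵁ (U ⊓ V) :=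
  fun _ ht => ht

/-- The pullback `f^* L`, with frames `f^* (e i)` on `f ⁻¹ (U i)`. -/
abbrev pullback (f : Y ⟶ X) (L : RLineBundle X) : RLineBundle Y where
  ι := L.ι
  U i := f ⁻¹ᵁ L.U i
  cover t := L.cover (f t)
  g i j := RUnits.pull f (U := L.U i ⊓ L.U j) (V := f ⁻¹ᵁ L.U i ⊓ f ⁻¹ᵁ L.U j)
    (preimage_inf_le f _ _) (L.g i j)
  cocycle i j k W hij hjk hik := by
    rw [RUnits.res_pull, RUnits.res_pull, RUnits.res_pull]
    have e : W ≤ f ⁻¹ᵁ (L.U i ⊓ L.U j ⊓ L.U k) := fun t ht => ⟨hij ht, (hik ht).2⟩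
    rw [← RUnits.pull_res f (inf_le_left : L.U i ⊓ L.U j ⊓ L.U k ≤ _) e,
      ← RUnits.pull_res f (le_inf (inf_le_left.trans inf_le_right) inf_le_right :
        L.U i ⊓ L.U j ⊓ L.U k ≤ L.U j ⊓ L.U k) e,
      ← RUnits.pull_res f (le_inf (inf_le_left.trans inf_le_left) inf_le_right :
        L.U i ⊓ L.U j ⊓ L.U k ≤ L.U i ⊓ L.U k) e, ← map_add, L.cocycle]

/-- An isomorphism `A ≅ B` of real line bundles: with frames `a i` of `A` and `b j` of `B`, the
isomorphism sends `a i` to `h i j * b j` on `A.U i ∩ B.U j`. -/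
structure Iso (A B : RLineBundle X) where
  h : ∀ i j, RUnits X (A.U i ⊓ B.U j)
  compat : ∀ (i i' : A.ι) (j j' : B.ι) (W : X.Opens) (hA : W ≤ A.U i ⊓ A.U i')
    (hij : W ≤ A.U i ⊓ B.U j) (hij' : W ≤ A.U i' ⊓ B.U j') (hB : W ≤ B.U j ⊓ B.U j'),
    RUnits.res hA (A.g i i') + RUnits.res hij (h i j) =
      RUnits.res hij' (h i' j') + RUnits.res hB (B.g j j')

/-- Ampleness in `Pic(X) ⊗ ℝ`: being isomorphic to a product `M₁ ^ r₁ ⊗ ⋯ ⊗ Mₙ ^ rₙ` (`1 ≤ n`)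
of ample line bundles with positive real exponents. -/
inductive IsAmple : RLineBundle X → Prop
  | pow (M : LineBundle X) (hM : M.IsAmple) (r : ℝ) (hr : 0 < r) : IsAmple (M.toReal.pow r)
  | tensor (A B : RLineBundle X) (hA : IsAmple A) (hB : IsAmple B) : IsAmple (A.tensor B)
  | iso (A B : RLineBundle X) (e : Iso A B) (hA : IsAmple A) : IsAmple B

theorem g_self (L : RLineBundle X) (i : L.ι) : L.g i i = 0 := by
  have h := L.cocycle i i i (L.U i ⊓ L.U i) le_rfl le_rfl le_rfl
  have h' : RUnits.res (le_refl (L.U i ⊓ L.U i)) (L.g i i) = 0 := by simpa using h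
  have : ∀ a : RUnits X (L.U i ⊓ L.U i), RUnits.res (le_refl _) a = a := by
    intro a
    unfold RUnits.res RUnits.ofHom
    induction a using TensorProduct.induction_on with
    | zero => simp
    | tmul r m =>
      rw [LinearMap.baseChange_tmul]
      congr 1
      apply Additive.toMul.injective
      apply Units.ext
      change (X.presheaf.map (𝟙 _)) _ = _
      simp
    | add x y hx hy => rw [map_add, hx, hy]
  rwa [this] at h'

end RLineBundle

/-! ### Geometric points and evaluation -/

section Points

variable {K : Type u} [Field K] {X : Scheme.{u}} (p : X ⟶ Spec (.of K))

/-- `X(C)`: the points of the `K`-scheme `X` with values in a field extension `C` of `K`. -/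
structure Pt (C : Type u) [Field C] [Algebra K C] where
  hom : Spec (.of C) ⟶ X
  isOver : hom ≫ p = Spec.map (CommRingCat.ofHom (algebraMap K C))

variable {p} {C : Type u} [Field C] [Algebra K C]

/-- The point `x` lies on the open subset `U`. -/
abbrev Pt.In (x : Pt p C) (U : X.Opens) : Prop := ⊤ ≤ x.hom ⁻¹ᵁ U

/-- The value `f(x) ∈ C` of a regular function on `U` at a point of `U(C)`. -/
def Pt.eval (x : Pt p C) {U : X.Opens} (hx : x.In U) : Γ(X, U) →+* C :=
  (x.hom.appLE U ⊤ hx ≫ (Scheme.ΓSpecIso (.of C)).hom).hom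

/-- The image of a point under a `K`-morphism `f : X ⟶ X`. -/
def Pt.map (x : Pt p C) (f : X ⟶ X) (hf : f ≫ p = p) : Pt p C where
  hom := x.hom ≫ f
  isOver := by rw [Category.assoc, hf, x.isOver]

theorem Pt.exists_in (x : Pt p C) {ι : Type} (U : ι → X.Opens) (hU : ∀ t : X, ∃ i, t ∈ U i) :
    ∃ i, x.In (U i) := by
  obtain ⟨i, hi⟩ := hU (x.hom (IsLocalRing.closedPoint C))
  refine ⟨i, fun t _ => ?_⟩
  have : t = IsLocalRing.closedPoint C := by
    apply PrimeSpectrum.ext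
    rw [(Ideal.eq_bot_or_top t.asIdeal).resolve_right t.isPrime.ne_top,
      (Ideal.eq_bot_or_top (IsLocalRing.closedPoint C).asIdeal).resolve_right
        (IsLocalRing.closedPoint C).isPrime.ne_top]
  rw [this]
  exact hi

variable (w : AbsoluteValue C ℝ)

/-- The topology on `X(C)` defined by the absolute value of `C`: the coarsest one for which `U(C)`
is open and `f : U(C) → C` is continuous, for all open `U` and all regular functions `f` on `U`. -/
abbrev ptTopology : TopologicalSpace (Pt p C) :=
  TopologicalSpace.generateFrom
    {S | ∃ (U : X.Opens) (f : Γ(X, U)) (a : C) (ε : ℝ),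
      S = {x | ∃ hx : x.In U, w (x.eval hx f - a) < ε}}

/-- A set of points of `V(C)` (with `V` affine) is bounded in `V` if every regular function on `V`
is bounded on it. -/
def IsBoundedIn (V : X.Opens) (E : Set (Pt p C)) : Prop :=
  ∃ hE : ∀ x ∈ E, x.In V, ∀ f : Γ(X, V), ∃ B : ℝ, ∀ x (hx : x ∈ E), w (x.eval (hE x hx) f) ≤ B

/-- `log |u(x)|` for a unit `u` with real exponents on `U` and a point `x ∈ U(C)`:
`log |(∏ fₖ ^ rₖ)(x)| = ∑ rₖ * log |fₖ(x)|`. -/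
def Pt.logAbs (x : Pt p C) {U : X.Opens} (hx : x.In U) : RUnits X U →ₗ[ℝ] ℝ :=
  LinearMap.liftBaseChange ℝ (AddMonoidHom.toIntLinearMap
    { toFun := fun m => Real.log (w (x.eval hx (Additive.toMul m).1))
      map_zero' := by simp
      map_add' := fun a b => by
        have ha : w (x.eval hx (Additive.toMul a).1) ≠ 0 := by
          simpa using ((Additive.toMul a).isUnit.map (x.eval hx)).ne_zero
        have hb : w (x.eval hx (Additive.toMul b).1) ≠ 0 := by
          simpa using ((Additive.toMul b).isUnit.map (x.eval hx)).ne_zero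
        simp only [toMul_add, Units.val_mul, map_mul, Real.log_mul ha hb] })

theorem Pt.logAbs_tmul (x : Pt p C) {U : X.Opens} (hx : x.In U) (r : ℝ) (m : Γ(X, U)ˣ) :
    x.logAbs w hx (r ⊗ₜ Additive.ofMul m) = r * Real.log (w (x.eval hx m.1)) := by
  simp [Pt.logAbs]

theorem Pt.logAbs_res (x : Pt p C) {U V : X.Opens} (e : V ≤ U) (hV : x.In V) (hU : x.In U)
    (a : RUnits X U) : x.logAbs w hV (RUnits.res e a) = x.logAbs w hU a := by
  induction a using TensorProduct.induction_on with
  | zero => simp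
  | tmul r m =>
    obtain ⟨m, rfl⟩ := Additive.ofMul.surjective m
    rw [Pt.logAbs_tmul]
    change x.logAbs w hV (r ⊗ₜ Additive.ofMul (Units.map _ m)) = _
    rw [Pt.logAbs_tmul]
    congr 3
    change (X.presheaf.map (homOfLE e).op ≫ x.hom.appLE V ⊤ hV ≫ _).hom m.1 = _
    rw [← Category.assoc, Scheme.Hom.map_appLE]
    rfl
  | add x y hx hy => simp only [map_add, hx, hy]

theorem Pt.logAbs_pull (x : Pt p C) (f : X ⟶ X) (hf : f ≫ p = p) {U V : X.Opens}
    (e : V ≤ f ⁻¹ᵁ U) (hV : x.In V) (hU : (x.map f hf).In U)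
    (a : RUnits X U) : x.logAbs w hV (RUnits.pull f e a) = (x.map f hf).logAbs w hU a := by
  induction a using TensorProduct.induction_on with
  | zero => simp
  | tmul r m =>
    obtain ⟨m, rfl⟩ := Additive.ofMul.surjective m
    rw [Pt.logAbs_tmul]
    change x.logAbs w hV (r ⊗ₜ Additive.ofMul (Units.map _ m)) = _
    rw [Pt.logAbs_tmul]
    congr 3
    change (f.appLE U V e ≫ x.hom.appLE V ⊤ hV ≫ _).hom m.1 = _
    rw [← Category.assoc, Scheme.Hom.appLE_comp_appLE]
    rfl
  | add x y hx hy => simp only [map_add, hx, hy]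

/-! ### Metrics -/

variable (p)

/-- A metric on the fibres of the real line bundle `L` at the points of `X(C)`, given by the
(logarithms of the) norms of the local frames: `logNorm i x = log ‖e i (x)‖` for `x ∈ U i`. As
`e j = g i j * e i`, homogeneity of the norm says that `‖e j (x)‖ = |g i j (x)| * ‖e i (x)‖`. -/
@[ext]
structure LMetric (L : RLineBundle X) where
  logNorm : ∀ (i : L.ι) (x : Pt p C), x.In (L.U i) → ℝ
  transition : ∀ (i j : L.ι) (x : Pt p C) (hi : x.In (L.U i)) (hj : x.In (L.U j))
    (hij : x.In (L.U i ⊓ L.U j)),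
    logNorm j x hj = x.logAbs w hij (L.g i j) + logNorm i x hi

variable {p w}

namespace LMetric

variable {L A B : RLineBundle X}

/-- Continuity for the topology of `X(C)`: the norm of each local frame is continuous. -/
def IsContinuous (N : LMetric p w L) : Prop :=
  letI := ptTopology (p := p) w
  ∀ i, Continuous fun x : {x : Pt p C // x.In (L.U i)} => N.logNorm i x.1 x.2

/-- Boundedness: the logarithm of the norm of each local frame is bounded on each bounded subset
of each affine open set contained in the domain of the frame. -/
def IsBounded (N : LMetric p w L) : Prop :=
  ∀ (i : L.ι) (V : X.Opens) (_ : V ≤ L.U i), IsAffineOpen V →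
    ∀ E : Set (Pt p C), IsBoundedIn w V E →
      ∃ B : ℝ, ∀ x ∈ E, ∀ hx : x.In (L.U i), |N.logNorm i x hx| ≤ B

/-- Uniform convergence `‖·‖ₙ → ‖·‖` on `X(C)`: the functions `log (‖·‖ₙ / ‖·‖)` converge
uniformly to zero. -/
def UnifTendsto (F : ℕ → LMetric p w L) (N : LMetric p w L) : Prop :=
  ∀ ε > 0, ∃ n₀ : ℕ, ∀ n ≥ n₀, ∀ (i : L.ι) (x : Pt p C) (hx : x.In (L.U i)),
    |(F n).logNorm i x hx - N.logNorm i x hx| < ε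

/-- The pullback metric `f^* ‖·‖` on `f^* L`. -/
def pullback (f : X ⟶ X) (hf : f ≫ p = p) (N : LMetric p w L) : LMetric p w (L.pullback f) where
  logNorm i x hx := N.logNorm i (x.map f hf) hx
  transition i j x hi hj hij := by
    rw [N.transition i j (x.map f hf) hi hj hij]
    congr 1
    exact (x.logAbs_pull w f hf (U := L.U i ⊓ L.U j)
      (RLineBundle.preimage_inf_le f _ _) hij hij _).symm

/-- The metric on `A` induced by an isomorphism `A ≅ B` and a metric on `B`: the norm of `a i` is
the norm of `h i j * b j`, for any `j` with `x ∈ B.U j`. -/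
def ofIso (e : RLineBundle.Iso A B) (N : LMetric p w B) : LMetric p w A where
  logNorm i x hx :=
    x.logAbs w (U := A.U i ⊓ B.U (x.exists_in B.U B.cover).choose)
        (le_inf hx (x.exists_in B.U B.cover).choose_spec) (e.h i _) +
      N.logNorm _ x (x.exists_in B.U B.cover).choose_spec
  transition i i' x hi hi' hii' := by
    obtain ⟨j, hj⟩ : ∃ j, j = (x.exists_in B.U B.cover).choose := ⟨_, rfl⟩
    have h₄ : x.In (B.U j) := hj ▸ (x.exists_in B.U B.cover).choose_spec
    have h₂ : x.In (A.U i ⊓ B.U j) := fun t ht => ⟨hi ht, h₄ ht⟩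
    have h₃ : x.In (A.U i' ⊓ B.U j) := fun t ht => ⟨hi' ht, h₄ ht⟩
    have h := e.compat i i' j j (A.U i ⊓ A.U i' ⊓ B.U j) inf_le_left
      (le_inf (inf_le_left.trans inf_le_left) inf_le_right)
      (le_inf (inf_le_left.trans inf_le_right) inf_le_right) (le_inf inf_le_right inf_le_right)
    have hx : x.In (A.U i ⊓ A.U i' ⊓ B.U j) := 
      fun t ht => ⟨⟨hi ht, hi' ht⟩, h₄ ht⟩
    have h' := congrArg (x.logAbs w hx) h
    rw [RLineBundle.g_self, map_zero, add_zero, map_add, x.logAbs_res w _ hx hii',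
      x.logAbs_res w _ hx h₂, x.logAbs_res w _ hx h₃] at h'
    subst hj
    linarith

/-- The metric `‖·‖ ^ (1 / r)` on `L` induced by a metric `‖·‖` on `L ^ r`. -/
def root {r : ℝ} (hr : r ≠ 0) (N : LMetric p w (L.pow r)) : LMetric p w L where
  logNorm i x hx := N.logNorm i x hx / r
  transition i j x hi hj hij := by
    rw [N.transition i j x hi hj hij]
    have : x.logAbs w hij ((L.pow r).g i j) = r * x.logAbs w hij (L.g i j) := by
      simp
    erw [this]
    field_simp

/-- The operator `‖·‖ ↦ (Φ^* f^* ‖·‖) ^ (1 / r)`, for an isomorphism `Φ : L ^ r ≅ f^* L`. -/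
def iter {r : ℝ} (hr : r ≠ 0) (f : X ⟶ X) (hf : f ≫ p = p)
    (Φ : RLineBundle.Iso (L.pow r) (L.pullback f)) (N : LMetric p w L) : LMetric p w L :=
  root hr (ofIso Φ (pullback f hf N))

/-- `N` is the canonical metric of the polarized dynamical system given by `f` and
`Φ : L ^ r ≅ f^* L`: it is the uniform limit, on `X(C)`, of the sequence
`‖·‖₁`, `‖·‖ₙ₊₁ = (Φ^* f^* ‖·‖ₙ) ^ (1 / r)`, for every continuous and bounded metric `‖·‖₁`. -/
def IsCanonical {r : ℝ} (hr : r ≠ 0) (f : X ⟶ X) (hf : f ≫ p = p)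
    (Φ : RLineBundle.Iso (L.pow r) (L.pullback f)) (N : LMetric p w L) : Prop :=
  N.IsContinuous ∧ N.IsBounded ∧
    ∀ N₁ : LMetric p w L, N₁.IsContinuous → N₁.IsBounded →
      UnifTendsto (fun n => (iter hr f hf Φ)^[n] N₁) N

end LMetric

end Points

/-- Compatibility of `Φ : L ^ α ≅ φ^* L` and `Ψ : L ^ β ≅ ψ^* L` with `φ ∘ ψ = ψ ∘ φ`: the two
isomorphisms `L ^ (αβ) ≅ (φ ∘ ψ)^* L` obtained from them,
`L ^ (αβ) ≅ (ψ^* L) ^ α ≅ ψ^* φ^* L` and `L ^ (αβ) ≅ (φ^* L) ^ β ≅ φ^* ψ^* L`, coincide (compared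
on every open `W` on which the frames in question are defined). -/
def Compatible {X : Scheme.{u}} {L : RLineBundle X} {φ ψ : X ⟶ X} {α β : ℝ}
    (Φ : RLineBundle.Iso (L.pow α) (L.pullback φ))
    (Ψ : RLineBundle.Iso (L.pow β) (L.pullback ψ)) : Prop :=
  ∀ (i j k l : L.ι) (W : X.Opens)
    (h₁ : W ≤ L.U i ⊓ ψ ⁻¹ᵁ L.U j) (h₂ : W ≤ ψ ⁻¹ᵁ (L.U j ⊓ φ ⁻¹ᵁ L.U l))
    (h₃ : W ≤ L.U i ⊓ φ ⁻¹ᵁ L.U k) (h₄ : W ≤ φ ⁻¹ᵁ (L.U k ⊓ ψ ⁻¹ᵁ L.U l)),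
    α • RUnits.res h₁ (Ψ.h i j) + RUnits.pull ψ h₂ (Φ.h j l) =
      β • RUnits.res h₃ (Φ.h i k) + RUnits.pull φ h₄ (Ψ.h k l)

/-! ### Places of a number field -/

section Places

variable (K : Type u) [Field K] [NumberField K]

/-- The places of `K`: infinite places and finite places (maximal ideals of the integers). -/
abbrev Place : Type u := InfinitePlace K ⊕ HeightOneSpectrum (𝓞 K)

variable {K}

/-- The completion `K_v`. -/
def Place.Compl : Place K → Type u
  | .inl v => v.Completion
  | .inr v => v.adicCompletion K

instance (v : Place K) : Field v.Compl :=
  match v with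
  | .inl v => inferInstanceAs (Field v.Completion)
  | .inr v => inferInstanceAs (Field (v.adicCompletion K))

instance (v : Place K) : Algebra K v.Compl :=
  match v with
  | .inl v => inferInstanceAs (Algebra K v.Completion)
  | .inr v => inferInstanceAs (Algebra K (v.adicCompletion K))

/-- The algebraic closure of `K_v`. -/
abbrev Place.Cl (v : Place K) : Type u := AlgebraicClosure v.Compl

/-- The absolute value on the algebraic closure of `K_v`, at an infinite place: it is induced by
an embedding into `ℂ` that extends the embedding of `K_v`. -/
def infAbs (v : InfinitePlace K) : AbsoluteValue (AlgebraicClosure v.Completion) ℝ :=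
  letI : Algebra v.Completion ℂ := (InfinitePlace.Completion.extensionEmbedding v).toAlgebra
  (NormedField.toAbsoluteValue ℂ).comp
    (IsAlgClosed.lift (R := v.Completion) (S := AlgebraicClosure v.Completion)
      (M := ℂ)).toRingHom.injective

/-- The absolute value on the algebraic closure of `K_v`, at a finite place: the spectral norm,
which is the unique extension of the absolute value of `K_v`. -/
def finAbs (v : HeightOneSpectrum (𝓞 K)) :
    AbsoluteValue (AlgebraicClosure (v.adicCompletion K)) ℝ :=
  letI : NontriviallyNormedField (v.adicCompletion K) := Valued.toNontriviallyNormedField _ _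
  MulRingNorm.mulRingNormEquivAbsoluteValue
    (spectralMulAlgNorm (v.adicCompletion K)
      (AlgebraicClosure (v.adicCompletion K))).toMulRingNorm

/-- The absolute value on the algebraic closure of `K_v`. -/
def Place.abs : (v : Place K) → AbsoluteValue v.Cl ℝ
  | .inl v => infAbs v
  | .inr v => finAbs v

end Places

end PolDyn

end

/-!
Everything is proved for an arbitrary field extension `C` of `K` and an arbitrary absolute value
`w` on `C`; the places of `K` only enter through the choice of `C` and `w`.

*Existence and uniqueness.* The operator `T : ‖·‖ ↦ (Φ^* φ^* ‖·‖) ^ (1 / α)` preserves continuity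
and boundedness of metrics (`LMetric.IsAdmissible.iter`) and divides the logarithmic distance of
two metrics by `α` (`LMetric.Close.iter`). Two inputs make Tate's limit argument
(`LMetric.exists_isCanonical`) work. An ample bundle has a continuous and bounded metric
(`RLineBundle.IsAmple.exists_isAdmissible`), built from the sum of the `|s k| ^ (1 / n k)` for
finitely many sections `s k` of powers `M ^ n k` without common zeros. And any two bounded metrics
are at finite distance (`LMetric.exists_close`), because `X(C)` is a finite union of bounded
subsets of affine open sets (`LineBundle.IsAmple.exists_bounded_cover`): on the locus of `s k`
every function is integral over `K[s j ^ n k / s k ^ n j]` (`isIntegral_locus`), hence bounded where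
`s k` has the largest normalized absolute value. The integrality is where properness enters: it is
tested on the valuation rings of the function field, each of which has a center on `X`
(`exists_center`).

*Comparison.* The canonical metric is the unique continuous and bounded fixed point of `T`. If `Φ`
and `Ψ` are compatible, the two operators commute (`Compatible.iter_comm`), so each preserves the
fixed point of the other and the fixed points agree.

*Global units.* The two isomorphisms `L ^ (α β) ≅ (φ ψ)^* L` built from arbitrary `Φ` and `Ψ` differ
by a global unit with real exponents, since such units glue (`RUnits.exists_glue`, by flatness of
`ℝ` over `ℤ`). Multiplying `Ψ` by `u` changes this unit by `α u - φ^* u`, and a canonical metric is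
changed by `c` when `Ψ` is changed by `β c - ψ^* c`. Both expressions take every value
(`RUnits.exists_smul_sub_pull_eq`), as the global functions on `X` form a finite extension of `K`,
on which `φ^*` and `ψ^*` have finite order.
-/

noncomputable section

namespace PolDyn

/-! ### Gluing units with real exponents -/

section Gluing

variable {X : Scheme.{u}}

theorem genericPoint_mem_of_mem [IrreducibleSpace X] {U : X.Opens} {t : X} (ht : t ∈ U) :
    genericPoint X ∈ U :=
  ((genericPoint_spec X).mem_open_set_iff U.isOpen).mpr (by simpa using ⟨t, ht⟩)

/-- The germ of an invertible function at the generic point. -/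
def unitsGerm [IrreducibleSpace X] (U : X.Opens) (hU : genericPoint X ∈ U) :
    Additive Γ(X, U)ˣ →ₗ[ℤ] Additive (X.functionField)ˣ :=
  (MonoidHom.toAdditive (Units.map
    ((X.presheaf.germ U (genericPoint X) hU).hom : Γ(X, U) →* X.functionField))).toIntLinearMap

theorem unitsGerm_injective [AlgebraicGeometry.IsIntegral X] (U : X.Opens)
    (hU : genericPoint X ∈ U) : Function.Injective (unitsGerm U hU) := fun a b h => by
  apply Additive.toMul.injective
  apply Units.ext
  apply germ_injective_of_isIntegral (X := X) (genericPoint X) hU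
  exact congrArg (fun z => (Additive.toMul z).1) h

/-- The germ at the generic point of a unit with real exponents. -/
def RUnits.germ [IrreducibleSpace X] (U : X.Opens) (hU : genericPoint X ∈ U) :
    RUnits X U →ₗ[ℤ] ℝ ⊗[ℤ] Additive (X.functionField)ˣ :=
  (unitsGerm U hU).lTensor ℝ

theorem RUnits.germ_injective [AlgebraicGeometry.IsIntegral X] (U : X.Opens)
    (hU : genericPoint X ∈ U) : Function.Injective (RUnits.germ U hU) :=
  Module.Flat.lTensor_preserves_injective_linearMap _ (unitsGerm_injective U hU)

theorem RUnits.germ_res [IrreducibleSpace X] {U V : X.Opens} (e : V ≤ U)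
    (hV : genericPoint X ∈ V) (a : RUnits X U) :
    RUnits.germ V hV (RUnits.res e a) = RUnits.germ U (e hV) a := by
  induction a using TensorProduct.induction_on with
  | zero => simp
  | tmul r m =>
    change r ⊗ₜ[ℤ] _ = r ⊗ₜ[ℤ] _
    congr 1
    apply Additive.toMul.injective
    apply Units.ext
    exact X.presheaf.germ_res_apply (homOfLE e) (genericPoint X) hV (Additive.toMul m).1
  | add x y hx hy => simp only [map_add, hx, hy]

/-- On the empty open set there are no nontrivial units. -/
theorem RUnits.eq_zero_of_forall_notMem {U : X.Opens} (hU : ∀ t : X, t ∉ U) (a : RUnits X U) :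
    a = 0 := by
  have : U = ⊥ := by ext t; simpa using hU t
  subst this
  have hs : Subsingleton (Additive Γ(X, ⊥)ˣ) := inferInstanceAs (Subsingleton Γ(X, ⊥)ˣ)
  induction a using TensorProduct.induction_on with
  | zero => rfl
  | tmul r m => rw [hs.elim m 0, TensorProduct.tmul_zero]
  | add x y hx hy => rw [hx, hy, add_zero]

/-- An element of the function field that is an invertible function on each set of an open cover
is an invertible function on `X`. -/
theorem exists_unitsGerm_top [AlgebraicGeometry.IsIntegral X] {κ : Type*} (V : κ → X.Opens)
    (hV : ∀ t : X, ∃ a, t ∈ V a) (hg : ∀ a, genericPoint X ∈ V a)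
    (z : Additive (X.functionField)ˣ) (hz : ∀ a, z ∈ LinearMap.range (unitsGerm (V a) (hg a))) :
    z ∈ LinearMap.range (unitsGerm (⊤ : X.Opens) trivial) := by
  -- the sheaf property for sections with a common germ at the generic point
  have key : ∀ (y : X.functionField) (f : ∀ a, Γ(X, V a)),
      (∀ a, X.presheaf.germ (V a) (genericPoint X) (hg a) (f a) = y) →
      ∃ s : Γ(X, ⊤), X.presheaf.germ ⊤ (genericPoint X) trivial s = y := by
    intro y f hf
    obtain ⟨s, hs, -⟩ := X.sheaf.existsUnique_gluing' V ⊤ (fun a => homOfLE le_top)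
      (fun t _ => by simpa using hV t) f (fun a b => by
        apply germ_injective_of_isIntegral (X := X) (genericPoint X) (U := V a ⊓ V b)
          ⟨hg a, hg b⟩
        exact (X.presheaf.germ_res_apply (homOfLE inf_le_left) (genericPoint X) _ (f a)).trans
          (((hf a).trans (hf b).symm).trans
            (X.presheaf.germ_res_apply (homOfLE inf_le_right) (genericPoint X) _ (f b)).symm))
    obtain ⟨a, -⟩ := hV (genericPoint X)
    refine ⟨s, ?_⟩
    rw [← hf a, ← hs a]
    exact (X.presheaf.germ_res_apply (homOfLE le_top) (genericPoint X) (hg a) s).symm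
  choose m hm using hz
  obtain ⟨s, hs⟩ := key (Additive.toMul z).1 (fun a => (Additive.toMul (m a)).1)
    (fun a => congrArg (fun z => (Additive.toMul z).1) (hm a))
  obtain ⟨s', hs'⟩ := key (Additive.toMul z)⁻¹.1 (fun a => (Additive.toMul (-m a)).1)
    (fun a => congrArg (fun z => (Additive.toMul (-z)).1) (hm a) |> fun h => by
      rw [← map_neg] at h
      exact h)
  have h1 : s * s' = 1 := by
    apply germ_injective_of_isIntegral (X := X) (genericPoint X) (U := ⊤) trivial
    erw [map_mul, map_one, hs, hs']
    simp
  refine ⟨Additive.ofMul ⟨s, s', h1, by rwa [mul_comm]⟩, ?_⟩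
  apply Additive.toMul.injective
  apply Units.ext
  exact hs

/-- Tensoring with a flat module commutes with finite intersections of submodules: an element of
`M ⊗ G` that comes from each of finitely many `M ⊗ N' a`, where `N' a → G`, comes from `M ⊗ N`
if the image of `N` is the intersection of the images of the `N' a`. -/
theorem mem_range_lTensor_of_forall_mem {R M G N κ : Type*} [CommRing R] [AddCommGroup M]
    [Module R M] [Module.Flat R M] [AddCommGroup G] [Module R G] [AddCommGroup N] [Module R N]
    [Finite κ] {N' : κ → Type*} [∀ a, AddCommGroup (N' a)] [∀ a, Module R (N' a)]
    (f : N →ₗ[R] G) (h : ∀ a, N' a →ₗ[R] G)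
    (hf : LinearMap.range f = ⨅ a, LinearMap.range (h a)) (z : M ⊗[R] G)
    (hz : ∀ a, z ∈ LinearMap.range ((h a).lTensor M)) : z ∈ LinearMap.range (f.lTensor M) := by
  classical
  have := Fintype.ofFinite κ
  let q : G →ₗ[R] (∀ a, G ⧸ LinearMap.range (h a)) :=
    LinearMap.pi fun a => (LinearMap.range (h a)).mkQ
  have hex : Function.Exact f q := by
    intro y
    rw [← LinearMap.coe_range, SetLike.mem_coe, hf, Submodule.mem_iInf, funext_iff]
    exact forall_congr' fun a => Submodule.Quotient.mk_eq_zero _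
  refine (Module.Flat.lTensor_exact M hex z).mp ?_
  apply (TensorProduct.piRight R R M (fun a => G ⧸ LinearMap.range (h a))).injective
  rw [map_zero]
  funext a
  have hcomp : ∀ y : M ⊗[R] G, TensorProduct.piRight R R M
      (fun a => G ⧸ LinearMap.range (h a)) (q.lTensor M y) a =
        (LinearMap.range (h a)).mkQ.lTensor M y := by
    intro y
    induction y using TensorProduct.induction_on with
    | zero => simp
    | tmul r m => simp [q]
    | add x y hx hy => simp only [map_add, Pi.add_apply, hx, hy]
  obtain ⟨y, hy⟩ := hz a
  have h0 : (LinearMap.range (h a)).mkQ ∘ₗ h a = 0 := by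
    ext m
    exact (Submodule.Quotient.mk_eq_zero _).mpr ⟨m, rfl⟩
  rw [hcomp, ← hy, ← LinearMap.lTensor_comp_apply, h0]
  simp

/-- Units with real exponents glue: `U ↦ 𝒪(U)ˣ ⊗ ℝ` satisfies the sheaf condition on an integral
quasi-compact scheme. All the groups of units are subgroups of the units of the function field,
and `𝒪(X)ˣ` is the intersection of finitely many `𝒪(V a)ˣ`. -/
theorem RUnits.exists_glue [AlgebraicGeometry.IsIntegral X] [CompactSpace X] {κ : Type*}
    (V : κ → X.Opens) (hV : ∀ t : X, ∃ a, t ∈ V a) (θ : ∀ a, RUnits X (V a))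
    (hθ : ∀ a b, RUnits.res (inf_le_left : V a ⊓ V b ≤ V a) (θ a) =
      RUnits.res (inf_le_right : V a ⊓ V b ≤ V b) (θ b)) :
    ∃ c : RUnits X ⊤, ∀ a, RUnits.res le_top c = θ a := by
  classical
  let κ' := {a : κ // genericPoint X ∈ V a}
  obtain ⟨s, hs⟩ := isCompact_univ.elim_finite_subcover (fun a : κ' => (V a.1 : Set X))
    (fun a => (V a.1).isOpen) (fun t _ => by
      obtain ⟨a, ha⟩ := hV t
      exact Set.mem_iUnion.mpr ⟨⟨a, genericPoint_mem_of_mem ha⟩, ha⟩)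
  have hV' : ∀ t : X, ∃ a : s, t ∈ V a.1.1 := fun t => by
    obtain ⟨a, ha, h⟩ := Set.mem_iUnion₂.mp (hs (Set.mem_univ t))
    exact ⟨⟨a, ha⟩, h⟩
  obtain ⟨a₀, -⟩ := hV' (genericPoint X)
  have hH : LinearMap.range (unitsGerm (⊤ : X.Opens) trivial) =
      ⨅ a : s, LinearMap.range (unitsGerm (V a.1.1) a.1.2) := by
    apply le_antisymm
    · rintro _ ⟨m, rfl⟩
      refine (Submodule.mem_iInf _).mpr fun a => ⟨(MonoidHom.toAdditive (Units.map
        ((X.presheaf.map (homOfLE (le_top : V a.1.1 ≤ ⊤)).op).hom :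
          Γ(X, ⊤) →* Γ(X, V a.1.1)))) m, ?_⟩
      apply Additive.toMul.injective
      apply Units.ext
      exact X.presheaf.germ_res_apply (homOfLE le_top) (genericPoint X) a.1.2 _
    · exact fun z hz => exists_unitsGerm_top (fun a : s => V a.1.1) hV' (fun a => a.1.2) z
        ((Submodule.mem_iInf _).mp hz)
  -- restriction to the function field is injective, so all the `θ a` have a common germ
  have hgerm : ∀ a b : κ', RUnits.germ (V a.1) a.2 (θ a.1) = RUnits.germ (V b.1) b.2 (θ b.1) := by
    intro a b
    have h := congrArg (RUnits.germ (V a.1 ⊓ V b.1) ⟨a.2, b.2⟩) (hθ a.1 b.1)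
    exact (RUnits.germ_res inf_le_left _ _).symm.trans (h.trans (RUnits.germ_res inf_le_right _ _))
  obtain ⟨c, hc⟩ := mem_range_lTensor_of_forall_mem (M := ℝ) _ _ hH
    (RUnits.germ (V a₀.1.1) a₀.1.2 (θ a₀.1.1)) (fun a => ⟨θ a.1.1, hgerm a.1 a₀.1⟩)
  refine ⟨c, fun a => ?_⟩
  by_cases ha : genericPoint X ∈ V a
  · apply RUnits.germ_injective (V a) ha
    rw [RUnits.germ_res]
    exact hc.trans (hgerm a₀.1 ⟨a, ha⟩)
  · have he : ∀ t : X, t ∉ V a := fun t ht => ha (genericPoint_mem_of_mem ht)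
    rw [RUnits.eq_zero_of_forall_notMem he (RUnits.res le_top c),
      RUnits.eq_zero_of_forall_notMem he (θ a)]

end Gluing

/-! ### The equation `r u - f^* u = c` -/

section Solve

variable {X : Scheme.{u}}

/-- A `K`-endomorphism of a proper integral `K`-scheme has finite order on global functions,
since these form a finite field extension of `K`. -/
theorem exists_pow_appTop_eq_one {K : Type u} [Field K] (p : X ⟶ Spec (.of K))
    [AlgebraicGeometry.IsIntegral X] [IsProper p] (f : X ⟶ X) (hf : f ≫ p = p) :
    ∃ m : ℕ, 0 < m ∧ ∀ s : Γ(X, ⊤), (f.appTop.hom)^[m] s = s := by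
  let A := Γ(Spec (.of K), ⊤)
  let eA : A ≃+* K := (Scheme.ΓSpecIso (.of K)).commRingCatIsoToRingEquiv
  let _ : Field A := (eA.toMulEquiv.isField (Field.toIsField K)).toField
  let _ : Field Γ(X, ⊤) := (isField_of_universallyClosed K p).toField
  let _ : Algebra A Γ(X, ⊤) := p.appTop.hom.toAlgebra
  have hfin : Module.Finite A Γ(X, ⊤) := finite_appTop_of_universallyClosed K p
  have hc : p.appTop ≫ f.appTop = p.appTop := by
    rw [← Scheme.Hom.comp_appTop, hf]
  let g : Γ(X, ⊤) →ₐ[A] Γ(X, ⊤) :=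
    { f.appTop.hom with
      commutes' := fun a => congrArg (fun h => h.hom a) hc }
  let e : Γ(X, ⊤) ≃ₐ[A] Γ(X, ⊤) := AlgEquiv.ofBijective g (Algebra.IsAlgebraic.algHom_bijective g)
  refine ⟨orderOf e, orderOf_pos e, fun s => ?_⟩
  have h := congrArg (fun σ => σ s) (pow_orderOf_eq_one e)
  have h2 : ∀ m : ℕ, (e ^ m) s = (f.appTop.hom)^[m] s := by
    intro m
    induction m with
    | zero => rfl
    | succ m ih =>
      rw [Function.iterate_succ_apply', ← ih, pow_succ']
      rfl
  rw [← h2]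
  exact h

/-- If `f^*` has finite order on global functions, `r - f^*` is surjective on global units with
real exponents for `r > 1`, because `r ^ m - 1 = (r - f^*) * ∑ r ^ (m - 1 - i) (f^*) ^ i`. -/
theorem RUnits.exists_smul_sub_pull_eq {K : Type u} [Field K] (p : X ⟶ Spec (.of K))
    [AlgebraicGeometry.IsIntegral X] [IsProper p] (f : X ⟶ X) (hf : f ≫ p = p) {r : ℝ}
    (hr : 1 < r) (c : RUnits X ⊤) :
    ∃ u : RUnits X ⊤,
      r • u - RUnits.pull f (f.preimage_top.ge : (⊤ : X.Opens) ≤ f ⁻¹ᵁ ⊤) u = c := by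
  obtain ⟨m, hm, hfm⟩ := exists_pow_appTop_eq_one p f hf
  let T : Module.End ℝ (RUnits X ⊤) := RUnits.pull f (f.preimage_top.ge : (⊤ : X.Opens) ≤ f ⁻¹ᵁ ⊤)
  have hTm : T ^ m = 1 := by
    have h : ∀ (n : ℕ) (a : ℝ) (s : Γ(X, ⊤)ˣ), ∃ s' : Γ(X, ⊤)ˣ,
        (T ^ n) (a ⊗ₜ Additive.ofMul s) = a ⊗ₜ Additive.ofMul s' ∧
          s'.1 = (f.appTop.hom)^[n] s.1 := by
      intro n a s
      induction n with
      | zero => exact ⟨s, rfl, rfl⟩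
      | succ n ih =>
        obtain ⟨s', h1, h2⟩ := ih
        refine ⟨Units.map (f.appTop.hom : Γ(X, ⊤) →* Γ(X, ⊤)) s', ?_, ?_⟩
        · rw [pow_succ', Module.End.mul_apply, h1]
          change a ⊗ₜ _ = a ⊗ₜ _
          congr 1
          apply Additive.toMul.injective
          apply Units.ext
          change (f.appLE ⊤ ⊤ _).hom s'.1 = f.appTop.hom s'.1
          exact congrArg (fun g => g.hom s'.1) (f.appLE_eq_app (U := ⊤))
        · rw [Function.iterate_succ_apply', ← h2]
          rfl
    refine LinearMap.ext fun z => ?_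
    induction z using TensorProduct.induction_on with
    | zero => simp
    | tmul a s =>
      obtain ⟨s', h1, h2⟩ := h m a (Additive.toMul s)
      rw [hfm] at h2
      rw [Units.ext h2] at h1
      exact h1
    | add x y hx hy => simp only [map_add, hx, hy]
  have hcomm : Commute (algebraMap ℝ (Module.End ℝ (RUnits X ⊤)) r) T := Algebra.commutes r T
  have hgeom := hcomm.mul_geom_sum₂ m
  have hpos : r ^ m - 1 ≠ 0 := (sub_pos.mpr (one_lt_pow₀ hr hm.ne')).ne'
  let S : Module.End ℝ (RUnits X ⊤) := ∑ i ∈ Finset.range m,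
    algebraMap ℝ (Module.End ℝ (RUnits X ⊤)) r ^ i * T ^ (m - 1 - i)
  refine ⟨(r ^ m - 1)⁻¹ • S c, ?_⟩
  have h := congrArg (fun A : Module.End ℝ (RUnits X ⊤) => A c) hgeom
  rw [hTm, ← map_pow] at h
  have h' : r • S c - T (S c) = (r ^ m - 1) • c := by
    rw [sub_smul, one_smul]
    exact h
  change r • (r ^ m - 1)⁻¹ • S c - T ((r ^ m - 1)⁻¹ • S c) = c
  rw [map_smul, smul_comm, ← smul_sub, h', smul_smul, inv_mul_cancel₀ hpos, one_smul]

end Solve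

/-! ### Evaluation at geometric points -/

theorem le_preimage_basicOpen_of_isUnit {X Y : Scheme.{u}} (l : Y ⟶ X) {U : X.Opens}
    {V : Y.Opens} (e : V ≤ l ⁻¹ᵁ U) {f : Γ(X, U)} (hf : IsUnit (l.appLE U V e f)) :
    V ≤ l ⁻¹ᵁ X.basicOpen f := by
  intro t ht
  rw [← Scheme.basicOpen_of_isUnit _ hf] at ht
  change t ∈ Y.basicOpen (Y.presheaf.map (homOfLE e).op (l.app U f)) at ht
  rw [Scheme.basicOpen_res] at ht
  rw [Scheme.preimage_basicOpen]
  exact ht.2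

section Eval

variable {K : Type u} [Field K] {X : Scheme.{u}} {p : X ⟶ Spec (.of K)}
  {C : Type u} [Field C] [Algebra K C]

theorem Pt.in_of_mem (x : Pt p C) {U : X.Opens}
    (h : x.hom (IsLocalRing.closedPoint C) ∈ U) : x.In U := fun t _ => by
  have : t = IsLocalRing.closedPoint C := Subsingleton.elim (α := PrimeSpectrum C) _ _
  rw [this]
  exact h

theorem Pt.mem_of_in {x : Pt p C} {U : X.Opens} (h : x.In U) :
    x.hom (IsLocalRing.closedPoint C) ∈ U :=
  h (show IsLocalRing.closedPoint C ∈ (⊤ : (Spec (.of C)).Opens) from trivial)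

theorem Pt.In.mono {x : Pt p C} {U V : X.Opens} (h : x.In V) (e : V ≤ U) : x.In U :=
  fun _ ht => e (h ht)

theorem Pt.In.inf {x : Pt p C} {U V : X.Opens} (hU : x.In U) (hV : x.In V) : x.In (U ⊓ V) :=
  fun _ ht => ⟨hU ht, hV ht⟩

theorem Pt.in_top (x : Pt p C) : x.In (⊤ : X.Opens) := fun _ _ => trivial

theorem Pt.eval_res (x : Pt p C) {U V : X.Opens} (e : V ≤ U) (hV : x.In V) (hU : x.In U)
    (f : Γ(X, U)) : x.eval hV (X.presheaf.map (homOfLE e).op f) = x.eval hU f := by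
  change (X.presheaf.map (homOfLE e).op ≫ x.hom.appLE V ⊤ hV ≫ _).hom f = _
  rw [← Category.assoc, Scheme.Hom.map_appLE]
  rfl

theorem Pt.eval_map (x : Pt p C) (f : X ⟶ X) (hf : f ≫ p = p) {U V : X.Opens}
    (e : V ≤ f ⁻¹ᵁ U) (hV : x.In V) (hU : (x.map f hf).In U) (s : Γ(X, U)) :
    (x.map f hf).eval hU s = x.eval hV (f.appLE U V e s) := by
  symm
  change (f.appLE U V e ≫ x.hom.appLE V ⊤ hV ≫ _).hom s = _
  rw [← Category.assoc, Scheme.Hom.appLE_comp_appLE]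
  rfl

/-- The function on `U` given by a constant. -/
def constHom (p : X ⟶ Spec (.of K)) (U : X.Opens) : K →+* Γ(X, U) :=
  ((Scheme.ΓSpecIso (.of K)).inv ≫ p.appLE ⊤ U (le_top.trans p.preimage_top.ge)).hom

theorem Pt.eval_const (x : Pt p C) {U : X.Opens} (hU : x.In U) (a : K) :
    x.eval hU (constHom p U a) = algebraMap K C a := by
  change ((Scheme.ΓSpecIso (.of K)).inv ≫ p.appLE ⊤ U (le_top.trans p.preimage_top.ge) ≫
    x.hom.appLE U ⊤ hU ≫ _).hom a = _
  have h : p.appLE ⊤ U (le_top.trans p.preimage_top.ge) ≫ x.hom.appLE U ⊤ hU =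
      (Spec.map (CommRingCat.ofHom (algebraMap K C))).appTop := by
    rw [Scheme.Hom.appLE_comp_appLE]
    simp only [x.isOver]
    exact Scheme.Hom.appLE_eq_app _
  rw [reassoc_of% h, Scheme.ΓSpecIso_naturality, Iso.inv_hom_id_assoc]
  rfl

theorem Pt.eval_ne_zero_of_isUnit (x : Pt p C) {U : X.Opens} (hU : x.In U) {f : Γ(X, U)}
    (hf : IsUnit f) : x.eval hU f ≠ 0 :=
  (hf.map (x.eval hU)).ne_zero

theorem Pt.in_basicOpen_iff (x : Pt p C) {U : X.Opens} (hU : x.In U) (f : Γ(X, U)) :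
    x.In (X.basicOpen f) ↔ x.eval hU f ≠ 0 := by
  constructor
  · intro h
    rw [← x.eval_res (X.basicOpen_le f) h hU f]
    exact x.eval_ne_zero_of_isUnit h (X.toRingedSpace.isUnit_res_basicOpen f)
  · intro h
    have h1 : IsUnit ((x.hom.appLE U ⊤ hU).hom f) := by
      have := (IsUnit.mk0 _ h).map (Scheme.ΓSpecIso (.of C)).inv.hom
      have h2 : (Scheme.ΓSpecIso (.of C)).inv.hom (x.eval hU f) = (x.hom.appLE U ⊤ hU).hom f := by
        change ((Scheme.ΓSpecIso (.of C)).hom ≫ (Scheme.ΓSpecIso (.of C)).inv).hom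
          ((x.hom.appLE U ⊤ hU).hom f) = _
        rw [Iso.hom_inv_id]
        rfl
      rwa [h2] at this
    exact le_preimage_basicOpen_of_isUnit x.hom hU h1

end Eval

/-! ### Bounded sets of points -/

section Bounded

variable {K : Type u} [Field K] {X : Scheme.{u}} {p : X ⟶ Spec (.of K)}
  {C : Type u} [Field C] [Algebra K C] {w : AbsoluteValue C ℝ}

theorem IsBoundedIn.mono {V : X.Opens} {E F : Set (Pt p C)} (hE : IsBoundedIn w V E)
    (h : F ⊆ E) : IsBoundedIn w V F := by
  obtain ⟨hin, hB⟩ := hE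
  exact ⟨fun x hx => hin x (h hx), fun f => (hB f).imp fun B hB x hx => hB x (h hx)⟩

/-- Functions generating the unit ideal do not become small simultaneously on a bounded set. -/
theorem IsBoundedIn.exists_le_of_span_eq_top {V : X.Opens} {E : Set (Pt p C)}
    (hE : IsBoundedIn w V E) {κ : Type*} [Finite κ] (f : κ → Γ(X, V))
    (hf : Ideal.span (Set.range f) = ⊤) :
    ∃ δ > 0, ∀ x ∈ E, ∀ hx : x.In V, ∃ k, δ ≤ w (x.eval hx (f k)) := by
  have := Fintype.ofFinite κ
  obtain ⟨hin, hB⟩ := hE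
  obtain ⟨c, hc⟩ := Ideal.mem_span_range_iff_exists_fun.mp
    (hf ▸ Submodule.mem_top : (1 : Γ(X, V)) ∈ Ideal.span (Set.range f))
  choose B hB using fun k => hB (c k)
  have hS : 0 < ∑ k, |B k| + 1 := by positivity
  refine ⟨1 / (∑ k, |B k| + 1), by positivity, fun x hxE hx => ?_⟩
  by_contra! hlt
  have h1 : (1 : ℝ) ≤ ∑ k, |B k| * (1 / (∑ k, |B k| + 1)) := by
    calc (1 : ℝ) = w (x.eval hx (∑ k, c k * f k)) := by rw [hc]; simp
      _ ≤ ∑ k, w (x.eval hx (c k * f k)) := by rw [map_sum]; exact w.sum_le _ _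
      _ ≤ _ := by
        refine Finset.sum_le_sum fun k _ => ?_
        rw [map_mul, map_mul]
        exact mul_le_mul ((hB k x hxE).trans (le_abs_self _)) (hlt k).le (w.nonneg _)
          (abs_nonneg _)
  rw [← Finset.sum_mul, mul_one_div, le_div_iff₀ hS] at h1
  linarith

/-- A bounded subset of `V` on which `f` stays away from zero is bounded in the locus of `f`, as
the functions there are quotients of functions on `V` by powers of `f`. -/
theorem IsBoundedIn.basicOpen {V : X.Opens} (hV : IsAffineOpen V) {E : Set (Pt p C)}
    (hE : IsBoundedIn w V E) (f : Γ(X, V)) {δ : ℝ} (hδ : 0 < δ)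
    (hf : ∀ x ∈ E, ∀ hx : x.In V, δ ≤ w (x.eval hx f)) : IsBoundedIn w (X.basicOpen f) E := by
  obtain ⟨hin, hB⟩ := hE
  have hin' : ∀ x ∈ E, x.In (X.basicOpen f) := fun x hx =>
    (x.in_basicOpen_iff (hin x hx) f).mpr fun h0 => by
      have := hf x hx (hin x hx)
      rw [h0, map_zero] at this
      linarith
  refine ⟨hin', fun g => ?_⟩
  have := hV.isLocalization_basicOpen f
  obtain ⟨⟨a, s⟩, ha⟩ := IsLocalization.surj (Submonoid.powers f) g
  obtain ⟨_, n, rfl⟩ := s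
  obtain ⟨B, hB⟩ := hB a
  refine ⟨B / δ ^ n, fun x hx => ?_⟩
  have h := congrArg (fun y => w (x.eval (hin' x hx) y)) ha
  simp only [map_mul, map_pow] at h
  have e1 : ∀ y : Γ(X, V), x.eval (hin' x hx) (algebraMap Γ(X, V) Γ(X, X.basicOpen f) y) =
      x.eval (hin x hx) y := fun y => x.eval_res (X.basicOpen_le f) _ _ y
  rw [e1, e1] at h
  rw [le_div_iff₀ (pow_pos hδ n)]
  calc _ ≤ w (x.eval (hin' x hx) g) * w (x.eval (hin x hx) f) ^ n :=
        mul_le_mul_of_nonneg_left (pow_le_pow_left₀ hδ.le (hf x hx _) n) (w.nonneg _)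
    _ ≤ B := by rw [h]; exact hB x hx

/-- A bounded subset of an affine open `V` can be cut into finitely many pieces, each bounded in
an affine open subset of `V` subordinate to a given open cover of `V`. So a bound valid on each
such piece is valid on the whole set. -/
theorem IsBoundedIn.exists_bound_of_local {V : X.Opens} (hV : IsAffineOpen V) {E : Set (Pt p C)}
    (hE : IsBoundedIn w V E) (P : Pt p C → ℝ → Prop) (hP : ∀ x B B', P x B → B ≤ B' → P x B')
    (S : Set X.Opens) (hS : ∀ t ∈ V, ∃ U ∈ S, t ∈ U)
    (h : ∀ U ∈ S, ∀ D : X.Opens, IsAffineOpen D → D ≤ V → D ≤ U → ∀ F ⊆ E, IsBoundedIn w D F →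
      ∃ B, ∀ x ∈ F, P x B) : ∃ B, ∀ x ∈ E, P x B := by
  -- the basic open sets subordinate to the cover give finitely many functions generating the unit
  -- ideal; the pieces are the sets where one of them is at least `δ`
  let s : Set Γ(X, V) := {f | ∃ U ∈ S, X.basicOpen f ≤ U}
  have hs : Ideal.span s = ⊤ := by
    rw [← hV.self_le_iSup_basicOpen_iff]
    intro t ht
    obtain ⟨U, hU, htU⟩ := hS t ht
    obtain ⟨f, hf, htf⟩ := hV.exists_basicOpen_le (V := U) ⟨t, htU⟩ ht
    exact (Opens.mem_iSup).mpr ⟨⟨f, U, hU, hf⟩, htf⟩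
  obtain ⟨s', hs's, hs'⟩ := (Ideal.span_eq_top_iff_finite s).mp hs
  obtain ⟨δ, hδ, hmax⟩ := hE.exists_le_of_span_eq_top (fun f : s' => f.1) (by simpa using hs')
  have hloc : ∀ f : s', ∃ B, ∀ x ∈ {x ∈ E | ∃ hx : x.In V, δ ≤ w (x.eval hx f.1)}, P x B := by
    intro f
    obtain ⟨U, hU, hfU⟩ := hs's f.2
    refine h U hU (X.basicOpen f.1) (hV.basicOpen f.1) (X.basicOpen_le f.1) hfU _
      (fun x hx => hx.1) ?_
    exact (hE.mono fun x hx => hx.1).basicOpen hV f.1 hδ fun x hx _ => hx.2.choose_spec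
  choose B hB using hloc
  refine ⟨∑ f, |B f|, fun x hx => ?_⟩
  obtain ⟨k, hk⟩ := hmax x hx (hE.choose x hx)
  refine hP x _ _ (hB k x ⟨hx, _, hk⟩) ((le_abs_self _).trans ?_)
  exact Finset.single_le_sum (f := fun f => |B f|) (fun _ _ => abs_nonneg _) (Finset.mem_univ k)

theorem IsBoundedIn.exists_bound_logAbs {V : X.Opens} {E : Set (Pt p C)}
    (hE : IsBoundedIn w V E) (a : RUnits X V) :
    ∃ B, ∀ x ∈ E, ∀ hx : x.In V, |x.logAbs w hx a| ≤ B := by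
  obtain ⟨hin, hB⟩ := hE
  induction a using TensorProduct.induction_on with
  | zero => exact ⟨0, fun x _ hx => by simp⟩
  | tmul r m =>
    obtain ⟨m, rfl⟩ := Additive.ofMul.surjective m
    obtain ⟨B₁, h₁⟩ := hB m.1
    obtain ⟨B₂, h₂⟩ := hB m⁻¹.1
    refine ⟨|r| * max B₁ B₂, fun x hxE hx => ?_⟩
    rw [Pt.logAbs_tmul, abs_mul]
    refine mul_le_mul_of_nonneg_left ?_ (abs_nonneg r)
    have hpos : 0 < w (x.eval hx m.1) := w.pos (x.eval_ne_zero_of_isUnit hx m.isUnit)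
    have hinv : w (x.eval hx m⁻¹.1) = (w (x.eval hx m.1))⁻¹ := by
      rw [← mul_eq_one_iff_eq_inv₀ hpos.ne', ← map_mul, ← map_mul, Units.inv_mul]
      simp
    rw [abs_le']
    constructor
    · exact ((Real.log_le_self hpos.le).trans (h₁ x hxE)).trans (le_max_left _ _)
    · rw [← Real.log_inv, ← hinv]
      exact ((Real.log_le_self (w.nonneg _)).trans (h₂ x hxE)).trans (le_max_right _ _)
  | add a b ha hb =>
    obtain ⟨B₁, h₁⟩ := ha
    obtain ⟨B₂, h₂⟩ := hb
    refine ⟨B₁ + B₂, fun x hxE hx => ?_⟩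
    rw [map_add]
    exact (abs_add_le _ _).trans (add_le_add (h₁ x hxE hx) (h₂ x hxE hx))

theorem IsBoundedIn.image_map (f : X ⟶ X) (hf : f ≫ p = p) {U V : X.Opens} (e : V ≤ f ⁻¹ᵁ U)
    {E : Set (Pt p C)} (hE : IsBoundedIn w V E) :
    IsBoundedIn w U ((fun x : Pt p C => x.map f hf) '' E) := by
  obtain ⟨hin, hB⟩ := hE
  have hin' : ∀ x ∈ E, (x.map f hf).In U := fun x hx t ht => e (hin x hx ht)
  refine ⟨?_, fun s => ?_⟩
  · rintro _ ⟨x, hx, rfl⟩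
    exact hin' x hx
  · obtain ⟨B, hB⟩ := hB (f.appLE U V e s)
    refine ⟨B, ?_⟩
    rintro _ ⟨x, hx, rfl⟩
    rw [x.eval_map f hf e (hin x hx)]
    exact hB x hx

/-- Functions that are bounded on a set of points form an integrally closed ring: if
`f ^ d + a₁ f ^ (d - 1) + ⋯ + a_d = 0` and the `a i` are bounded, then so is `f`. -/
theorem exists_bound_of_isIntegral {U : X.Opens} {E : Set (Pt p C)} (A : Subring Γ(X, U))
    (hA : ∀ a ∈ A, ∃ B, ∀ x ∈ E, ∀ hx : x.In U, w (x.eval hx a) ≤ B) {f : Γ(X, U)}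
    (hf : IsIntegral A f) : ∃ B, ∀ x ∈ E, ∀ hx : x.In U, w (x.eval hx f) ≤ B := by
  obtain ⟨q, hq, hqf⟩ := hf
  choose B hB using fun i => hA (q.coeff i).1 (q.coeff i).2
  refine ⟨max 1 (∑ i ∈ Finset.range q.natDegree, |B i|), fun x hxE hx => ?_⟩
  set y := w (x.eval hx f)
  by_contra! hlt
  obtain ⟨hy1, hyS⟩ := max_lt_iff.mp hlt
  have h0 : x.eval hx f ^ q.natDegree =
      -∑ i ∈ Finset.range q.natDegree, x.eval hx (q.coeff i).1 * x.eval hx f ^ i := by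
    have := congrArg (x.eval hx) hqf
    rw [Polynomial.eval₂_eq_sum_range, Finset.sum_range_succ, Polynomial.Monic.coeff_natDegree hq]
      at this
    simp only [map_one, one_mul, map_add, map_sum, map_mul, map_pow, map_zero] at this
    rw [eq_neg_iff_add_eq_zero, add_comm]
    exact this
  have hd : q.natDegree ≠ 0 := fun hd => by
    rw [hd] at h0
    simp at h0
  obtain ⟨d, hd⟩ := Nat.exists_eq_succ_of_ne_zero hd
  have h1 : y ^ q.natDegree ≤ (∑ i ∈ Finset.range q.natDegree, |B i|) * y ^ d := by
    calc y ^ q.natDegree = w (x.eval hx f ^ q.natDegree) := (map_pow w _ _).symm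
      _ ≤ ∑ i ∈ Finset.range q.natDegree, w (x.eval hx (q.coeff i).1 * x.eval hx f ^ i) := by
        rw [h0, w.map_neg]; exact w.sum_le _ _
      _ ≤ _ := by
        rw [Finset.sum_mul]
        refine Finset.sum_le_sum fun i hi => ?_
        rw [map_mul, map_pow]
        refine mul_le_mul ((hB i x hxE hx).trans (le_abs_self _)) ?_
          (pow_nonneg (w.nonneg _) _) (abs_nonneg _)
        exact pow_le_pow_right₀ hy1.le (by have := Finset.mem_range.mp hi; omega)
  rw [hd, pow_succ'] at h1
  have h2 := le_of_mul_le_mul_right h1 (pow_pos (zero_lt_one.trans hy1) d)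
  rw [← hd] at h2
  linarith

end Bounded

/-! ### Centers of valuation rings and integrality -/

section Center

variable {K : Type u} [Field K] {X : Scheme.{u}}

theorem constHom_res (p : X ⟶ Spec (.of K)) {U V : X.Opens} (e : V ≤ U) (a : K) :
    X.presheaf.map (homOfLE e).op (constHom p U a) = constHom p V a := by
  change ((Scheme.ΓSpecIso (.of K)).inv ≫ p.appLE ⊤ U _ ≫
    X.presheaf.map (homOfLE e).op).hom a = _
  rw [Scheme.Hom.appLE_map]
  rfl

theorem fromSpecStalk_appLE_ΓSpecIso_hom {t : X} (m : Spec (X.presheaf.stalk t) ⟶ X)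
    (hm : m = X.fromSpecStalk t) {U : X.Opens} (ht : t ∈ U) (e : ⊤ ≤ m ⁻¹ᵁ U) :
    m.appLE U ⊤ e ≫ (Scheme.ΓSpecIso (X.presheaf.stalk t)).hom = X.presheaf.germ U t ht := by
  subst hm
  rw [Scheme.Hom.appLE, Scheme.fromSpecStalk_app ht]
  simp only [Category.assoc, ← Functor.map_comp_assoc]
  erw [CategoryTheory.Functor.map_id, Category.id_comp, Iso.inv_hom_id, Category.comp_id]

/-- A valuation ring `R` of the function field of a proper integral `K`-scheme that contains `K`
dominates the local ring of a point `t`: functions regular at `t` lie in `R`, and those which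
are invertible in `R` do not vanish at `t`. -/
theorem exists_center (p : X ⟶ Spec (.of K)) [AlgebraicGeometry.IsIntegral X] [IsProper p]
    (R : ValuationSubring X.functionField)
    (hR : ∀ a, X.presheaf.germ ⊤ (genericPoint X) trivial (constHom p ⊤ a) ∈ R) :
    ∃ t : X, ∀ (U : X.Opens) (ht : t ∈ U) (f : Γ(X, U)),
      X.presheaf.germ U (genericPoint X) (genericPoint_mem_of_mem ht) f ∈ R ∧
      (∀ g ∈ R, X.presheaf.germ U (genericPoint X) (genericPoint_mem_of_mem ht) f * g = 1 →
        t ∈ X.basicOpen f) := by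
  let i₂ : CommRingCat.of K ⟶ CommRingCat.of R := CommRingCat.ofHom
    (((X.presheaf.germ ⊤ (genericPoint X) trivial).hom.comp (constHom p ⊤)).codRestrict
      R.toSubring hR)
  let j : CommRingCat.of R ⟶ X.functionField := CommRingCat.ofHom (algebraMap R X.functionField)
  have hj : i₂ ≫ j = (Scheme.ΓSpecIso (.of K)).inv ≫
      p.appTop ≫ X.presheaf.germ ⊤ (genericPoint X) trivial := by
    have h : p.appTop = p.appLE ⊤ ⊤ p.preimage_top.ge := (Scheme.Hom.appLE_eq_app _).symm
    rw [h]
    rfl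
  have hsq : X.fromSpecStalk (genericPoint X) ≫ p = Spec.map j ≫ Spec.map i₂ := by
    rw [← Spec.map_comp, hj, ← cancel_mono ((Spec (.of K)).toSpecΓ), Category.assoc,
      Scheme.toSpecΓ_naturality, Scheme.fromSpecStalk_toSpecΓ_assoc, ← SpecMap_ΓSpecIso_hom,
      ← Spec.map_comp, ← Spec.map_comp, Iso.hom_inv_id_assoc]
  have hex : ValuativeCriterion.Existence p := by
    have : UniversallyClosed p := inferInstance
    rw [UniversallyClosed.eq_valuativeCriterion] at this
    exact this.1
  obtain ⟨l, hl⟩ : ∃ l : Spec (.of R) ⟶ X,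
      Spec.map j ≫ l = X.fromSpecStalk (genericPoint X) := by
    obtain ⟨⟨l, hl, -⟩⟩ := (hex ⟨R, X.functionField, X.fromSpecStalk (genericPoint X),
      Spec.map i₂, ⟨hsq⟩⟩).exists_lift
    exact ⟨l, hl⟩
  have hclosed : ∀ U : X.Opens, l (IsLocalRing.closedPoint R) ∈ U → ⊤ ≤ l ⁻¹ᵁ U :=
    fun U hU => (Scheme.preimage_eq_top_of_closedPoint_mem l hU).ge
  refine ⟨l (IsLocalRing.closedPoint R), fun U ht f => ?_⟩
  let r : R := (Scheme.ΓSpecIso (.of R)).hom (l.appLE U ⊤ (hclosed U ht) f)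
  have hr : X.presheaf.germ U (genericPoint X) (genericPoint_mem_of_mem ht) f = r.1 := by
    have h1 : l.appLE U ⊤ (hclosed U ht) ≫ (Scheme.ΓSpecIso (.of R)).hom ≫ j =
        X.presheaf.germ U (genericPoint X) (genericPoint_mem_of_mem ht) := by
      rw [← Scheme.ΓSpecIso_naturality, ← Category.assoc]
      have h2 : l.appLE U ⊤ (hclosed U ht) ≫ (Spec.map j).appTop =
          (Spec.map j ≫ l).appLE U ⊤ (fun t _ => hclosed U ht trivial) := by
        rw [← Scheme.Hom.appLE_comp_appLE _ _ U ⊤ ⊤ (hclosed U ht) (Spec.map j).preimage_top.ge]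
        exact congrArg _ (Scheme.Hom.appLE_eq_app _).symm
      rw [h2]
      exact fromSpecStalk_appLE_ΓSpecIso_hom _ hl _ _
    exact (congrArg (fun g => g.hom f) h1).symm
  refine ⟨hr ▸ r.2, fun g hg hfg => ?_⟩
  have hru : IsUnit r := by
    refine .of_mul_eq_one ⟨g, hg⟩ (Subtype.ext ?_)
    rw [hr] at hfg
    exact hfg
  refine le_preimage_basicOpen_of_isUnit l (hclosed U ht) ?_ (show _ ∈ ⊤ from trivial)
  have := hru.map (Scheme.ΓSpecIso (.of R)).inv.hom
  have h2 : (Scheme.ΓSpecIso (.of R)).inv.hom r = l.appLE U ⊤ (hclosed U ht) f := by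
    change ((Scheme.ΓSpecIso (.of R)).hom ≫ (Scheme.ΓSpecIso (.of R)).inv).hom
      (l.appLE U ⊤ (hclosed U ht) f) = _
    rw [Iso.hom_inv_id]
    rfl
  rwa [h2] at this

/-- Integrality over a ring of functions on `U` can be tested by the valuation rings of the
function field that contain it. -/
theorem isIntegral_of_forall_valuationSubring [AlgebraicGeometry.IsIntegral X] {U : X.Opens}
    (hU : genericPoint X ∈ U) (S : Set Γ(X, U)) (f : Γ(X, U))
    (h : ∀ R : ValuationSubring X.functionField,
      (∀ a ∈ S, X.presheaf.germ U (genericPoint X) hU a ∈ R) →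
        X.presheaf.germ U (genericPoint X) hU f ∈ R) :
    IsIntegral (Subring.closure S) f := by
  let γ : Γ(X, U) →+* X.functionField := (X.presheaf.germ U (genericPoint X) hU).hom
  have hγ : Function.Injective γ := germ_injective_of_isIntegral X _ hU
  have h1 : γ f ∈ (integralClosure (Subring.closure (γ '' S)) X.functionField).toSubring := by
    rw [← iInf_valuationSubring_superset, Subring.mem_iInf]
    exact fun R => h R.1 fun a ha => R.2 ⟨a, ha, rfl⟩
  have h2 : IsIntegral (Subring.closure (γ '' S)) (γ f) := h1
  rw [← RingHom.map_closure] at h2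
  obtain ⟨q, hq, hqf⟩ := h2
  let e : Subring.closure S →+* (Subring.closure S).map γ :=
    (γ.comp (Subring.closure S).subtype).codRestrict _ fun a => ⟨a, a.2, rfl⟩
  have he : Function.Surjective e := by
    rintro ⟨_, a, ha, rfl⟩
    exact ⟨⟨a, ha⟩, rfl⟩
  obtain ⟨q', hq', -, hq'm⟩ := Polynomial.lifts_and_degree_eq_and_monic
    ((Polynomial.mem_lifts _).mpr (Polynomial.map_surjective e he q)) hq
  refine ⟨q', hq'm, hγ ?_⟩
  rw [map_zero, ← hqf, ← hq', Polynomial.eval₂_map, Polynomial.hom_eval₂]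
  rfl

end Center

/-! ### Bounded covers from ample line bundles -/

section AmpleCover

variable {K : Type u} [Field K] {X : Scheme.{u}} {p : X ⟶ Spec (.of K)}
  {C : Type u} [Field C] [Algebra K C] {w : AbsoluteValue C ℝ}

theorem LineBundle.IsAmple.exists_finite_sections {M : LineBundle X} (hM : M.IsAmple) :
    ∃ (κ : Type u) (_ : Finite κ) (n : κ → ℕ) (s : ∀ k, M.PowSection (n k)),
      (∀ k, 0 < n k) ∧ (∀ k, IsAffineOpen (s k).locus) ∧ ∀ t : X, ∃ k, t ∈ (s k).locus := by
  obtain ⟨hX, h⟩ := hM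
  choose n hn s ht ha using h
  obtain ⟨I, hI⟩ := isCompact_univ.elim_finite_subcover (fun t => ((s t).locus : Set X))
    (fun t => (s t).locus.isOpen) (fun t _ => Set.mem_iUnion.mpr ⟨t, ht t⟩)
  refine ⟨I, inferInstance, fun t => n t, fun t => s t, fun t => hn t, fun t => ha t, fun t => ?_⟩
  obtain ⟨a, haI, h⟩ := Set.mem_iUnion₂.mp (hI (Set.mem_univ t))
  exact ⟨⟨a, haI⟩, h⟩

theorem exists_inv_basicOpen {U : X.Opens} (f : Γ(X, U)) : ∃ g : Γ(X, X.basicOpen f),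
    g * X.presheaf.map (homOfLE (X.basicOpen_le f)).op f = 1 :=
  (X.toRingedSpace.isUnit_res_basicOpen f).exists_left_inv

namespace LineBundle.PowSection

variable {M : LineBundle X} {n : ℕ} (s : M.PowSection n)

theorem basicOpen_le_locus (i : M.ι) : X.basicOpen (s.coeff i) ≤ s.locus :=
  le_iSup (fun i => X.basicOpen (s.coeff i)) i

theorem germ_coeff [IrreducibleSpace X] (i j : M.ι) (hi : genericPoint X ∈ M.U i)
    (hj : genericPoint X ∈ M.U j) :
    X.presheaf.germ (M.U i) (genericPoint X) hi (s.coeff i) =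
      X.presheaf.germ (M.U i ⊓ M.U j) (genericPoint X) ⟨hi, hj⟩ (M.g i j).1 ^ n *
        X.presheaf.germ (M.U j) (genericPoint X) hj (s.coeff j) := by
  have h := congrArg (X.presheaf.germ (M.U i ⊓ M.U j) (genericPoint X) ⟨hi, hj⟩) (s.glue i j)
  rw [map_mul, map_pow] at h
  exact (X.presheaf.germ_res_apply (homOfLE inf_le_left) (genericPoint X) ⟨hi, hj⟩ _).symm.trans
    (h.trans (congrArg _
      (X.presheaf.germ_res_apply (homOfLE inf_le_right) (genericPoint X) ⟨hi, hj⟩ _)))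

theorem eval_coeff (x : Pt p C) (i j : M.ι) (hi : x.In (M.U i)) (hj : x.In (M.U j)) :
    x.eval hi (s.coeff i) = x.eval (hi.inf hj) (M.g i j).1 ^ n * x.eval hj (s.coeff j) := by
  have h := congrArg (x.eval (hi.inf hj)) (s.glue i j)
  rwa [map_mul, map_pow, Pt.eval_res _ _ _ hi, Pt.eval_res _ _ _ hj] at h

theorem eval_coeff_ne_zero (x : Pt p C) (i : M.ι) (hi : x.In (M.U i)) (hx : x.In s.locus) :
    x.eval hi (s.coeff i) ≠ 0 := by
  obtain ⟨j, hj⟩ := Opens.mem_iSup.mp (Pt.mem_of_in hx)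
  have hjin := x.in_of_mem hj
  have hjU := hjin.mono (X.basicOpen_le _)
  rw [s.eval_coeff x i j hi hjU]
  exact mul_ne_zero (pow_ne_zero _ (x.eval_ne_zero_of_isUnit _ (M.g i j).isUnit))
    ((x.in_basicOpen_iff hjU _).mp hjin)

end LineBundle.PowSection

/-- Let `s k` be sections of powers `M ^ n k` without common zeros on a proper integral scheme.
Then the functions on the locus of `s k` are integral over `K[s j ^ n k / s k ^ n j]`. These
quotients are expressed in a frame of `M` over `U i`, as functions `y j`. -/
theorem isIntegral_locus (p : X ⟶ Spec (.of K)) [AlgebraicGeometry.IsIntegral X] [IsProper p]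
    {M : LineBundle X} {κ : Type*} {n : κ → ℕ} (s : ∀ k, M.PowSection (n k))
    (hn : ∀ k, 0 < n k) (hs : ∀ t : X, ∃ k, t ∈ (s k).locus) (k : κ) (i : M.ι)
    (hD : genericPoint X ∈ X.basicOpen ((s k).coeff i))
    (y : κ → Γ(X, X.basicOpen ((s k).coeff i)))
    (hy : ∀ j, y j * X.presheaf.map (homOfLE (X.basicOpen_le _)).op ((s k).coeff i) ^ n j =
      X.presheaf.map (homOfLE (X.basicOpen_le _)).op ((s j).coeff i) ^ n k)
    (f : Γ(X, (s k).locus)) :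
    IsIntegral (Subring.closure (Set.range (constHom p (X.basicOpen ((s k).coeff i))) ∪
      Set.range y)) (X.presheaf.map (homOfLE ((s k).basicOpen_le_locus i)).op f) := by
  refine isIntegral_of_forall_valuationSubring hD _ _ fun R hR => ?_
  have hres : ∀ {U V : X.Opens} (e : V ≤ U) (hV : genericPoint X ∈ V) (g : Γ(X, U)),
      X.presheaf.germ V (genericPoint X) hV (X.presheaf.map (homOfLE e).op g) =
        X.presheaf.germ U (genericPoint X) (e hV) g := fun e hV g =>
    X.presheaf.germ_res_apply (homOfLE e) (genericPoint X) hV g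
  obtain ⟨t, ht⟩ := exists_center p R fun a => by
    have := hR (constHom p (X.basicOpen ((s k).coeff i)) a) (Or.inl ⟨a, rfl⟩)
    rwa [← constHom_res p (le_top : X.basicOpen ((s k).coeff i) ≤ ⊤), hres] at this
  obtain ⟨j, hj⟩ := hs t
  obtain ⟨i', hi'⟩ := Opens.mem_iSup.mp hj
  have hti' : t ∈ M.U i' := X.basicOpen_le _ hi'
  have hgi : genericPoint X ∈ M.U i := X.basicOpen_le _ hD
  have hgi' : genericPoint X ∈ M.U i' := genericPoint_mem_of_mem hti'
  let σ : ∀ (l : κ) (m : M.ι), genericPoint X ∈ M.U m → X.functionField := fun l m hm =>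
    X.presheaf.germ (M.U m) (genericPoint X) hm ((s l).coeff m)
  let γ : X.functionField :=
    X.presheaf.germ (M.U i' ⊓ M.U i) (genericPoint X) ⟨hgi', hgi⟩ (M.g i' i).1
  have hγ : γ ≠ 0 := ((M.g i' i).isUnit.map _).ne_zero
  have hσ : ∀ l, σ l i' hgi' = γ ^ n l * σ l i hgi := fun l =>
    (s l).germ_coeff i' i hgi' hgi
  have hne : ∀ (l : κ) (m : M.ι) (hm : genericPoint X ∈ M.U m),
      genericPoint X ∈ X.basicOpen ((s l).coeff m) → σ l m hm ≠ 0 := fun l m hm h =>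
    ((X.mem_basicOpen _ _ hm).mp h).ne_zero
  have hk0 : σ k i' hgi' ≠ 0 := by
    rw [hσ]; exact mul_ne_zero (pow_ne_zero _ hγ) (hne k i hgi hD)
  have hj0 : σ j i' hgi' ≠ 0 := hne j i' hgi' (genericPoint_mem_of_mem hi')
  -- `s j` does not vanish at `t`, so its coefficient is a unit of `R`
  have hjinv : (σ j i' hgi')⁻¹ ∈ R := by
    obtain ⟨g, hg⟩ := exists_inv_basicOpen ((s j).coeff i')
    have h1 := (ht _ hi' g).1
    have h2 : X.presheaf.germ _ (genericPoint X) (genericPoint_mem_of_mem hi') g *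
        σ j i' hgi' = 1 := by
      have h := congrArg
        (X.presheaf.germ _ (genericPoint X) (genericPoint_mem_of_mem hi')) hg
      rwa [map_mul, map_one, hres] at h
    rwa [eq_inv_of_mul_eq_one_left h2] at h1
  have hkR : σ k i' hgi' ∈ R := (ht _ hti' _).1
  -- hence, as the quotient `s j ^ n k / s k ^ n j` lies in `R`, so does the inverse of `s k`
  have hyR := hR (y j) (Or.inr ⟨j, rfl⟩)
  set η := X.presheaf.germ (X.basicOpen ((s k).coeff i)) (genericPoint X) hD (y j)
  have hyσ : η * σ k i hgi ^ n j = σ j i hgi ^ n k := by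
    have h := congrArg (X.presheaf.germ (X.basicOpen ((s k).coeff i)) (genericPoint X) hD) (hy j)
    rwa [map_mul, map_pow, map_pow, hres, hres] at h
  have hpow : (σ k i' hgi' ^ n j)⁻¹ = η * (σ j i' hgi')⁻¹ ^ n k := by
    have h1 : η * σ k i' hgi' ^ n j = σ j i' hgi' ^ n k := by
      rw [hσ, hσ, mul_pow, mul_pow, ← pow_mul, ← pow_mul, ← hyσ, mul_comm (n k)]
      ring
    rw [inv_pow, ← div_eq_mul_inv, eq_div_iff (pow_ne_zero _ hj0), ← h1]
    field_simp
  have hpowR : (σ k i' hgi' ^ n j)⁻¹ ∈ R := hpow ▸ mul_mem hyR (pow_mem hjinv _)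
  have hkinv : (σ k i' hgi')⁻¹ ∈ R := by
    obtain ⟨m, hm⟩ := Nat.exists_eq_succ_of_ne_zero (hn j).ne'
    have : (σ k i' hgi')⁻¹ = σ k i' hgi' ^ m * (σ k i' hgi' ^ n j)⁻¹ := by
      rw [hm, pow_succ]
      field_simp
    rw [this]
    exact mul_mem (pow_mem hkR _) hpowR
  have htk : t ∈ (s k).locus := (s k).basicOpen_le_locus i'
    ((ht _ hti' _).2 _ hkinv (mul_inv_cancel₀ hk0))
  rw [hres]
  exact (ht _ htk f).1

/-- The points of a proper integral scheme with an ample line bundle form a bounded set: they are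
covered by finitely many bounded subsets of affine open sets. The pieces are the sets of points
where one of finitely many sections of powers of the bundle has the largest normalized size. -/
theorem LineBundle.IsAmple.exists_bounded_cover [AlgebraicGeometry.IsIntegral X] [IsProper p]
    {M : LineBundle X} (hM : M.IsAmple) (w : AbsoluteValue C ℝ) :
    ∃ (κ : Type u) (_ : Finite κ) (V : κ → X.Opens) (E : κ → Set (Pt p C)),
      (∀ a, IsAffineOpen (V a) ∧ IsBoundedIn w (V a) (E a)) ∧ ∀ x, ∃ a, x ∈ E a := by
  obtain ⟨κ, hκ, n, s, hn, haff, hs⟩ := hM.exists_finite_sections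
  obtain ⟨hX, -⟩ := hM
  obtain ⟨I, hI⟩ := isCompact_univ.elim_finite_subcover (fun i => (M.U i : Set X))
    (fun i => (M.U i).isOpen) (fun t _ => Set.mem_iUnion.mpr (M.cover t))
  let E : κ × I → Set (Pt p C) := fun a => {x | ∃ hD : x.In (X.basicOpen ((s a.1).coeff a.2.1)),
    ∀ j, w (x.eval (hD.mono (X.basicOpen_le _)) ((s j).coeff a.2.1)) ^ n a.1 ≤
      w (x.eval (hD.mono (X.basicOpen_le _)) ((s a.1).coeff a.2.1)) ^ n j}
  refine ⟨κ × I, inferInstance, fun a => (s a.1).locus, E, fun a => ⟨haff _, ?_⟩, fun x => ?_⟩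
  · obtain ⟨k, i⟩ := a
    have hin : ∀ x ∈ E (k, i), x.In (s k).locus := fun x hx =>
      hx.choose.mono ((s k).basicOpen_le_locus i)
    refine ⟨hin, fun f => ?_⟩
    by_cases hD : genericPoint X ∈ X.basicOpen ((s k).coeff i)
    · obtain ⟨g, hg⟩ := exists_inv_basicOpen ((s k).coeff i.1)
      let y : κ → Γ(X, X.basicOpen ((s k).coeff i.1)) := fun j =>
        X.presheaf.map (homOfLE (X.basicOpen_le _)).op ((s j).coeff i) ^ n k *
          g ^ n j
      have hy : ∀ j, y j * X.presheaf.map (homOfLE (X.basicOpen_le _)).op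
          ((s k).coeff i.1) ^ n j =
          X.presheaf.map (homOfLE (X.basicOpen_le _)).op ((s j).coeff i.1) ^ n k := fun j => by
        rw [mul_assoc, ← mul_pow, hg, one_pow, mul_one]
      have hint := isIntegral_locus p s hn hs k i hD y hy f
      have hA : ∀ a ∈ Subring.closure (Set.range (constHom p (X.basicOpen ((s k).coeff i.1))) ∪
          Set.range y), ∃ B, ∀ x ∈ E (k, i), ∀ hx, w (x.eval hx a) ≤ B := by
        intro a ha
        induction ha using Subring.closure_induction with
        | mem a ha =>
          rcases ha with ⟨c, rfl⟩ | ⟨j, rfl⟩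
          · exact ⟨w (algebraMap K C c), fun x _ hx => by rw [Pt.eval_const]⟩
          · refine ⟨1, fun x hxE hx => ?_⟩
            have h1 := congrArg (fun g => w (x.eval hx g)) (hy j)
            have hxU := hx.mono (X.basicOpen_le _)
            simp only [map_mul, map_pow, Pt.eval_res _ _ _ hxU] at h1
            have hpos : 0 < w (x.eval hxU ((s k).coeff i)) ^ n j :=
              pow_pos (w.pos ((x.in_basicOpen_iff hxU _).mp hx)) _
            refine le_of_mul_le_mul_right ?_ hpos
            rw [h1, one_mul]
            exact hxE.choose_spec j
        | zero => exact ⟨0, fun x _ hx => by simp⟩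
        | one => exact ⟨1, fun x _ hx => by simp⟩
        | add a b _ _ ha hb =>
          obtain ⟨A, hA⟩ := ha
          obtain ⟨B, hB⟩ := hb
          exact ⟨A + B, fun x hxE hx => by
            rw [map_add]
            exact (w.add_le _ _).trans (add_le_add (hA x hxE hx) (hB x hxE hx))⟩
        | neg a _ ha =>
          obtain ⟨A, hA⟩ := ha
          exact ⟨A, fun x hxE hx => by rw [map_neg, w.map_neg]; exact hA x hxE hx⟩
        | mul a b _ _ ha hb =>
          obtain ⟨A, hA⟩ := ha
          obtain ⟨B, hB⟩ := hb
          exact ⟨A * B, fun x hxE hx => by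
            rw [map_mul, map_mul]
            exact mul_le_mul (hA x hxE hx) (hB x hxE hx) (w.nonneg _)
              ((w.nonneg _).trans (hA x hxE hx))⟩
      obtain ⟨B, hB⟩ := exists_bound_of_isIntegral _ hA hint
      refine ⟨B, fun x hx => ?_⟩
      have := hB x hx hx.choose
      rwa [Pt.eval_res _ _ _ (hin x hx)] at this
    -- otherwise the basic open set, and with it the piece, is empty
    · exact ⟨0, fun x hx => (hD (genericPoint_mem_of_mem (Pt.mem_of_in hx.choose))).elim⟩
  · obtain ⟨i, hiI, hi⟩ := Set.mem_iUnion₂.mp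
      (hI (Set.mem_univ (x.hom (IsLocalRing.closedPoint C))))
    have hxi : x.In (M.U i) := x.in_of_mem hi
    obtain ⟨k₀, hk₀⟩ := hs (x.hom (IsLocalRing.closedPoint C))
    have hne₀ := (s k₀).eval_coeff_ne_zero x i hxi (x.in_of_mem hk₀)
    have : Nonempty κ := ⟨k₀⟩
    -- the maximal normalized absolute value is positive, since some section does not vanish at `x`
    obtain ⟨k, hk⟩ := Finite.exists_max
      fun k => w (x.eval hxi ((s k).coeff i)) ^ (1 / (n k : ℝ))
    have hpos : 0 < w (x.eval hxi ((s k).coeff i)) := by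
      refine (w.nonneg _).lt_of_ne fun h0 => ?_
      have h1 := hk k₀
      rw [← h0, Real.zero_rpow (by have := hn k; positivity)] at h1
      exact (Real.rpow_pos_of_pos (w.pos hne₀) _).not_ge h1
    refine ⟨(k, ⟨i, hiI⟩), (x.in_basicOpen_iff hxi _).mpr (w.pos_iff.mp hpos), fun j => ?_⟩
    have h1 := pow_le_pow_left₀ (Real.rpow_nonneg (w.nonneg _) _) (hk j) (n j * n k)
    have h2 : ∀ (l m : κ), (w (x.eval hxi ((s l).coeff i)) ^ (1 / (n l : ℝ))) ^ (n l * n m) =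
        w (x.eval hxi ((s l).coeff i)) ^ n m := fun l m => by
      rw [pow_mul, ← Real.rpow_natCast _ (n l), ← Real.rpow_mul (w.nonneg _),
        one_div_mul_cancel (by have := hn l; positivity), Real.rpow_one]
    rw [h2, mul_comm (n j), h2] at h1
    exact h1

end AmpleCover

/-! ### Continuous functions on the geometric points of an open set -/

section Continuity

variable {K : Type u} [Field K] {X : Scheme.{u}} {p : X ⟶ Spec (.of K)}
  {C : Type u} [Field C] [Algebra K C] {w : AbsoluteValue C ℝ}

/-- Continuity of a real function on `U(C)` for the topology defined by the absolute value `w`. -/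
def ContOn (w : AbsoluteValue C ℝ) (U : X.Opens) (G : ∀ x : Pt p C, x.In U → ℝ) : Prop :=
  letI := ptTopology (p := p) w
  Continuous fun x : {x : Pt p C // x.In U} => G x.1 x.2

theorem isOpen_setOf_in (w : AbsoluteValue C ℝ) (U : X.Opens) :
    @IsOpen _ (ptTopology (p := p) w) {x : Pt p C | x.In U} := by
  refine TopologicalSpace.GenerateOpen.basic _ ⟨U, 0, 0, 1, ?_⟩
  ext x
  exact ⟨fun hx => ⟨hx, by simp⟩, fun ⟨hx, _⟩ => hx⟩

theorem ContOn.of_local {U : X.Opens} {G : ∀ x : Pt p C, x.In U → ℝ}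
    (h : ∀ x : Pt p C, x.In U → ∃ V : X.Opens, x.In V ∧
      ContOn w (U ⊓ V) fun y hy => G y (hy.mono inf_le_left)) : ContOn w U G := by
  let _ := ptTopology (p := p) w
  refine continuous_iff_continuousAt.mpr fun ⟨x, hx⟩ => ?_
  obtain ⟨V, hxV, hG⟩ := h x hx
  let O : Set {x : Pt p C // x.In U} := {y | y.1.In V}
  have hO : IsOpen O := (isOpen_setOf_in w V).preimage continuous_subtype_val
  have hcont : ContinuousOn (fun y : {x : Pt p C // x.In U} => G y.1 y.2) O := by
    rw [continuousOn_iff_continuous_domRestrict]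
    exact Continuous.comp (g := fun y : {y : Pt p C // y.In (U ⊓ V)} =>
      G y.1 (y.2.mono inf_le_left)) hG (f := fun y : O => ⟨y.1.1, y.1.2.inf y.2⟩)
      (Continuous.subtype_mk (continuous_subtype_val.comp continuous_subtype_val) _)
  exact hcont.continuousAt (hO.mem_nhds hxV)

theorem ContOn.mono {U V : X.Opens} {G : ∀ x : Pt p C, x.In U → ℝ} (h : ContOn w U G)
    (e : V ≤ U) : ContOn w V fun x hx => G x (hx.mono e) := by
  let _ := ptTopology (p := p) w
  exact Continuous.comp (g := fun y : {y : Pt p C // y.In U} => G y.1 y.2) h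
    (f := fun y : {y : Pt p C // y.In V} => ⟨y.1, y.2.mono e⟩)
    (Continuous.subtype_mk continuous_subtype_val _)

theorem ContOn.add {U : X.Opens} {G H : ∀ x : Pt p C, x.In U → ℝ} (hG : ContOn w U G)
    (hH : ContOn w U H) : ContOn w U fun x hx => G x hx + H x hx := by
  let _ := ptTopology (p := p) w
  exact Continuous.add hG hH

theorem ContOn.const_mul {U : X.Opens} {G : ∀ x : Pt p C, x.In U → ℝ} (r : ℝ)
    (hG : ContOn w U G) : ContOn w U fun x hx => r * G x hx := by
  let _ := ptTopology (p := p) w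
  exact Continuous.mul continuous_const hG

theorem continuous_map (w : AbsoluteValue C ℝ) (f : X ⟶ X) (hf : f ≫ p = p) :
    letI := ptTopology (p := p) w
    Continuous fun x : Pt p C => x.map f hf := by
  let _ := ptTopology (p := p) w
  refine continuous_generateFrom_iff.mpr ?_
  rintro _ ⟨U, s, a, ε, rfl⟩
  refine TopologicalSpace.GenerateOpen.basic _ ⟨f ⁻¹ᵁ U, f.app U s, a, ε, ?_⟩
  ext x
  have h : ∀ hx : x.In (f ⁻¹ᵁ U), (x.map f hf).eval hx s = x.eval hx (f.app U s) := fun hx => by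
    have h1 := x.eval_map f hf (U := U) le_rfl hx hx s
    rwa [Scheme.Hom.appLE_eq_app] at h1
  exact ⟨fun ⟨hx, hlt⟩ => ⟨hx, h hx ▸ hlt⟩, fun ⟨hx, hlt⟩ => ⟨hx, (h hx).symm ▸ hlt⟩⟩

theorem ContOn.comp_map {U : X.Opens} {G : ∀ x : Pt p C, x.In U → ℝ} (h : ContOn w U G)
    (f : X ⟶ X) (hf : f ≫ p = p) : ContOn w (f ⁻¹ᵁ U) fun x hx => G (x.map f hf) hx := by
  let _ := ptTopology (p := p) w
  exact Continuous.comp (g := fun y : {y : Pt p C // y.In U} => G y.1 y.2) h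
    (f := fun y : {y : Pt p C // y.In (f ⁻¹ᵁ U)} => ⟨y.1.map f hf, y.2⟩)
    (Continuous.subtype_mk ((continuous_map w f hf).comp continuous_subtype_val) _)

theorem contOn_eval {U : X.Opens} (s : Γ(X, U)) :
    ContOn (p := p) w U fun x hx => w (x.eval hx s) := by
  let _ := ptTopology (p := p) w
  refine continuous_iff_continuousAt.mpr fun ⟨x, hx⟩ => Metric.tendsto_nhds.mpr fun ε hε => ?_
  have hO : IsOpen {y : Pt p C | ∃ hy : y.In U, w (y.eval hy s - x.eval hx s) < ε} :=
    TopologicalSpace.GenerateOpen.basic _ ⟨U, s, x.eval hx s, ε, rfl⟩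
  filter_upwards [(hO.preimage continuous_subtype_val).mem_nhds
    (show ∃ hy : x.In U, w (x.eval hy s - x.eval hx s) < ε from ⟨hx, by simpa using hε⟩)]
    with y hy
  obtain ⟨hy, hlt⟩ := hy
  rw [Real.dist_eq]
  exact (w.abs_abv_sub_le_abv_sub _ _).trans_lt hlt

theorem contOn_logAbs {U : X.Opens} (a : RUnits X U) :
    ContOn (p := p) w U fun x hx => x.logAbs w hx a := by
  let _ := ptTopology (p := p) w
  induction a using TensorProduct.induction_on with
  | zero =>
    simp only [map_zero]
    exact continuous_const
  | tmul r m =>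
    obtain ⟨m, rfl⟩ := Additive.ofMul.surjective m
    simp only [Pt.logAbs_tmul]
    exact ContOn.const_mul r (Continuous.log (contOn_eval m.1) fun x =>
      (w.pos (x.1.eval_ne_zero_of_isUnit x.2 m.isUnit)).ne')
  | add a b ha hb =>
    simp only [map_add]
    exact ContOn.add ha hb

theorem contOn_of_uniform_limit {U : X.Opens} (F : ℕ → ∀ x : Pt p C, x.In U → ℝ)
    {G : ∀ x : Pt p C, x.In U → ℝ} (hF : ∀ n, ContOn w U (F n))
    (h : ∀ ε > 0, ∃ n, ∀ x hx, |F n x hx - G x hx| < ε) : ContOn w U G := by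
  let _ := ptTopology (p := p) w
  refine continuous_of_uniform_approx_of_continuous fun s hs => ?_
  obtain ⟨ε, hε, hεs⟩ := Metric.mem_uniformity_dist.mp hs
  obtain ⟨n, hn⟩ := h ε hε
  refine ⟨_, hF n, fun x => hεs ?_⟩
  rw [dist_comm, Real.dist_eq]
  exact hn x.1 x.2

end Continuity

/-! ### Continuous and bounded metrics -/

section Metrics

variable {K : Type u} [Field K] {X : Scheme.{u}} {p : X ⟶ Spec (.of K)}
  {C : Type u} [Field C] [Algebra K C] {w : AbsoluteValue C ℝ}

/-- The inverse of an isomorphism of real line bundles. -/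
def RLineBundle.Iso.symm {A B : RLineBundle X} (e : RLineBundle.Iso A B) :
    RLineBundle.Iso B A where
  h j i := -RUnits.res (le_inf inf_le_right inf_le_left) (e.h i j)
  compat j j' i i' W hB hji hji' hA := by
    have h := e.compat i i' j j' W hA (le_inf (hji.trans inf_le_right) (hji.trans inf_le_left))
      (le_inf (hji'.trans inf_le_right) (hji'.trans inf_le_left)) hB
    rw [map_neg, map_neg, RUnits.res_res, RUnits.res_res, ← sub_eq_add_neg, neg_add_eq_sub,
      sub_eq_sub_iff_add_eq_add, add_comm, ← h, add_comm]

namespace LMetric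

variable {L A B : RLineBundle X}

/-- Metrics that are both continuous and bounded. -/
def IsAdmissible (N : LMetric p w L) : Prop := N.IsContinuous ∧ N.IsBounded

theorem IsContinuous.contOn {N : LMetric p w L} (hN : N.IsContinuous) (i : L.ι) :
    ContOn w (L.U i) (N.logNorm i) := hN i

/-- The value of the induced metric may be computed with any frame of `B` at the point. -/
theorem ofIso_logNorm (e : RLineBundle.Iso A B) (N : LMetric p w B) (i : A.ι) (j : B.ι)
    (x : Pt p C) (hi : x.In (A.U i)) (hj : x.In (B.U j)) :
    (ofIso e N).logNorm i x hi = x.logAbs w (hi.inf hj) (e.h i j) + N.logNorm j x hj := by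
  let j' := (x.exists_in B.U B.cover).choose
  have hj' : x.In (B.U j') := (x.exists_in B.U B.cover).choose_spec
  change x.logAbs w (hi.inf hj') (e.h i j') + N.logNorm j' x hj' = _
  have h := congrArg (x.logAbs w ((hi.inf hj).inf hj'))
    (e.compat i i j j' (A.U i ⊓ B.U j ⊓ B.U j')
      (le_inf (inf_le_left.trans inf_le_left) (inf_le_left.trans inf_le_left)) inf_le_left
      (le_inf (inf_le_left.trans inf_le_left) inf_le_right)
      (le_inf (inf_le_left.trans inf_le_right) inf_le_right))
  rw [RLineBundle.g_self, map_zero, zero_add, map_add, x.logAbs_res w _ _ (hi.inf hj),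
    x.logAbs_res w _ _ (hi.inf hj'), x.logAbs_res w _ _ (hj.inf hj')] at h
  have h2 := N.transition j j' x hj hj' (hj.inf hj')
  linarith

theorem IsAdmissible.ofIso (e : RLineBundle.Iso A B) {N : LMetric p w B} (hN : N.IsAdmissible) :
    (ofIso e N).IsAdmissible := by
  constructor
  · intro i
    refine ContOn.of_local (U := A.U i) (G := fun x hx => (LMetric.ofIso e N).logNorm i x hx)
      fun x hx => ?_
    obtain ⟨j, hj⟩ := x.exists_in B.U B.cover
    refine ⟨B.U j, hj, ?_⟩
    have h : (fun (y : Pt p C) (hy : y.In (A.U i ⊓ B.U j)) =>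
        (LMetric.ofIso e N).logNorm i y (hy.mono inf_le_left)) =
        fun y hy => y.logAbs w hy (e.h i j) + N.logNorm j y (hy.mono inf_le_right) :=
      funext₂ fun y hy => ofIso_logNorm e N i j y _ _
    rw [h]
    exact (contOn_logAbs (e.h i j)).add ((hN.1.contOn j).mono inf_le_right)
  · intro i V hVi hV E hE
    refine hE.exists_bound_of_local hV
      (fun x b => ∀ hx : x.In (A.U i), |(LMetric.ofIso e N).logNorm i x hx| ≤ b)
      (fun x b b' h hb hx => (h hx).trans hb) (Set.range B.U) (fun t _ => ?_) ?_
    · obtain ⟨j, hj⟩ := B.cover t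
      exact ⟨_, ⟨j, rfl⟩, hj⟩
    · rintro _ ⟨j, rfl⟩ D hD hDV hDU F - hF
      obtain ⟨b₁, h₁⟩ := hF.exists_bound_logAbs
        (RUnits.res (le_inf (hDV.trans hVi) hDU) (e.h i j))
      obtain ⟨b₂, h₂⟩ := hN.2 j D hDU hD F hF
      refine ⟨b₁ + b₂, fun x hx hi => ?_⟩
      have hxD := hF.choose x hx
      have h₃ := h₁ x hx hxD
      rw [x.logAbs_res w _ hxD (hi.inf (hxD.mono hDU))] at h₃
      rw [ofIso_logNorm e N i j x hi (hxD.mono hDU)]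
      exact (abs_add_le _ _).trans (add_le_add h₃ (h₂ x hx _))

theorem IsAdmissible.pullback (f : X ⟶ X) (hf : f ≫ p = p) {N : LMetric p w L}
    (hN : N.IsAdmissible) : (pullback f hf N).IsAdmissible := by
  constructor
  · exact fun i => ContOn.comp_map (hN.1.contOn i) f hf
  · intro i V hVi hV E hE
    refine hE.exists_bound_of_local hV
      (fun x b => ∀ hx : (x.map f hf).In (L.U i), |N.logNorm i (x.map f hf) hx| ≤ b)
      (fun x b b' h hb hx => (h hx).trans hb)
      {U | ∃ W : X.Opens, IsAffineOpen W ∧ W ≤ L.U i ∧ U = f ⁻¹ᵁ W} (fun t ht => ?_) ?_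
    · obtain ⟨W, hW, htW, hWi⟩ := Opens.isBasis_iff_nbhd.mp X.isBasis_affineOpens
        (show f t ∈ L.U i from hVi ht)
      exact ⟨_, ⟨W, hW, hWi, rfl⟩, htW⟩
    · rintro _ ⟨W, hW, hWi, rfl⟩ D hD - hDU F - hF
      obtain ⟨b, hb⟩ := hN.2 i W hWi hW _ (hF.image_map f hf hDU)
      exact ⟨b, fun x hx => hb _ ⟨x, hx, rfl⟩⟩

theorem IsAdmissible.root {r : ℝ} (hr : r ≠ 0) {N : LMetric p w (L.pow r)}
    (hN : N.IsAdmissible) : (root hr N).IsAdmissible := by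
  constructor
  · intro i
    have h := (hN.1.contOn i).const_mul r⁻¹
    simp only [inv_mul_eq_div] at h
    exact h
  · intro i V hVi hV E hE
    obtain ⟨b, hb⟩ := hN.2 i V hVi hV E hE
    refine ⟨b / |r|, fun x hx hi => ?_⟩
    change |N.logNorm i x hi / r| ≤ _
    rw [abs_div]
    exact div_le_div_of_nonneg_right (hb x hx hi) (abs_nonneg r)

theorem IsAdmissible.iter {r : ℝ} (hr : r ≠ 0) (f : X ⟶ X) (hf : f ≫ p = p)
    (Φ : RLineBundle.Iso (L.pow r) (L.pullback f)) {N : LMetric p w L} (hN : N.IsAdmissible) :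
    (iter hr f hf Φ N).IsAdmissible :=
  ((hN.pullback f hf).ofIso Φ).root hr

/-- The metric `‖·‖ ^ r` on `L ^ r`. -/
def pow (N : LMetric p w L) (r : ℝ) : LMetric p w (L.pow r) where
  logNorm i x hx := r * N.logNorm i x hx
  transition i j x hi hj hij := by
    rw [N.transition i j x hi hj hij, mul_add]
    congr 1
    exact (map_smul (x.logAbs w hij) r (L.g i j)).symm

theorem IsAdmissible.pow {N : LMetric p w L} (hN : N.IsAdmissible) (r : ℝ) :
    (N.pow r).IsAdmissible := by
  constructor
  · exact fun i => (hN.1.contOn i).const_mul r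
  · intro i V hVi hV E hE
    obtain ⟨b, hb⟩ := hN.2 i V hVi hV E hE
    refine ⟨|r| * b, fun x hx hi => ?_⟩
    change |r * N.logNorm i x hi| ≤ _
    rw [abs_mul]
    exact mul_le_mul_of_nonneg_left (hb x hx hi) (abs_nonneg r)

/-- The product metric on a tensor product. -/
def tensor (N : LMetric p w A) (N' : LMetric p w B) : LMetric p w (A.tensor B) where
  logNorm i x hx := N.logNorm i.1 x (hx.mono inf_le_left) + N'.logNorm i.2 x (hx.mono inf_le_right)
  transition i j x hi hj hij := by
    have hA := N.transition i.1 j.1 x (hi.mono inf_le_left) (hj.mono inf_le_left)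
      ((hi.mono inf_le_left).inf (hj.mono inf_le_left))
    have hB := N'.transition i.2 j.2 x (hi.mono inf_le_right) (hj.mono inf_le_right)
      ((hi.mono inf_le_right).inf (hj.mono inf_le_right))
    have h := map_add (x.logAbs w hij)
      (RUnits.res (inf_le_inf inf_le_left inf_le_left) (A.g i.1 j.1))
      (RUnits.res (inf_le_inf inf_le_right inf_le_right) (B.g i.2 j.2))
    have hA' := x.logAbs_res w (inf_le_inf inf_le_left inf_le_left) hij
      ((hi.mono inf_le_left).inf (hj.mono inf_le_left)) (A.g i.1 j.1)
    have hB' := x.logAbs_res w (inf_le_inf inf_le_right inf_le_right) hij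
      ((hi.mono inf_le_right).inf (hj.mono inf_le_right)) (B.g i.2 j.2)
    have key : ∀ {a a' b b' c d c' d' e : ℝ}, a' = c + a → b' = d + b → e = c' + d' → c' = c →
        d' = d → a' + b' = e + (a + b) := fun h₁ h₂ h₃ h₄ h₅ => by linarith
    exact key hA hB h hA' hB'

theorem IsAdmissible.tensor {N : LMetric p w A} {N' : LMetric p w B} (hN : N.IsAdmissible)
    (hN' : N'.IsAdmissible) : (N.tensor N').IsAdmissible := by
  constructor
  · exact fun i => ((hN.1.contOn i.1).mono inf_le_left).add
      ((hN'.1.contOn i.2).mono inf_le_right)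
  · intro i V hVi hV E hE
    obtain ⟨b, hb⟩ := hN.2 i.1 V (hVi.trans inf_le_left) hV E hE
    obtain ⟨b', hb'⟩ := hN'.2 i.2 V (hVi.trans inf_le_right) hV E hE
    exact ⟨b + b', fun x hx hi =>
      (abs_add_le _ _).trans (add_le_add (hb x hx _) (hb' x hx _))⟩

/-- The metric `|c| ‖·‖` for a global unit `c` with real exponents. -/
def shift (N : LMetric p w L) (c : RUnits X ⊤) : LMetric p w L where
  logNorm i x hx := x.logAbs w x.in_top c + N.logNorm i x hx
  transition i j x hi hj hij := by
    rw [N.transition i j x hi hj hij]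
    ring

theorem IsAdmissible.shift {N : LMetric p w L} (hN : N.IsAdmissible) (c : RUnits X ⊤) :
    (N.shift c).IsAdmissible := by
  constructor
  · exact fun i => ((contOn_logAbs c).mono le_top).add (hN.1.contOn i)
  · intro i V hVi hV E hE
    obtain ⟨b, hb⟩ := hN.2 i V hVi hV E hE
    obtain ⟨b', hb'⟩ := hE.exists_bound_logAbs (RUnits.res le_top c)
    refine ⟨b' + b, fun x hx hi => (abs_add_le _ _).trans (add_le_add ?_ (hb x hx _))⟩
    have := hb' x hx (hE.choose x hx)
    rwa [x.logAbs_res w _ _ x.in_top] at this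

end LMetric

/-! ### Metrics on ample bundles -/

theorem LineBundle.PowSection.inf_locus_le {M : LineBundle X} {n : ℕ} (s : M.PowSection n)
    (i : M.ι) : M.U i ⊓ s.locus ≤ X.basicOpen (s.coeff i) := by
  rintro t ⟨hi, ht⟩
  obtain ⟨j, hj⟩ := Opens.mem_iSup.mp ht
  have h := congrArg (fun f => X.basicOpen f) (s.glue i j)
  simp only [Scheme.basicOpen_mul] at h
  rw [Scheme.basicOpen_of_isUnit _ ((M.g i j).isUnit.pow n), Scheme.basicOpen_res,
    Scheme.basicOpen_res] at h
  have ht' : t ∈ (M.U i ⊓ M.U j) ⊓ ((M.U i ⊓ M.U j) ⊓ X.basicOpen (s.coeff j)) :=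
    ⟨⟨hi, X.basicOpen_le _ hj⟩, ⟨hi, X.basicOpen_le _ hj⟩, hj⟩
  rw [← h] at ht'
  exact ht'.2

theorem abs_log_le_of_le_of_le {δ y B : ℝ} (hδ : 0 < δ) (h : δ ≤ y) (h' : y ≤ B) :
    |Real.log y| ≤ max B δ⁻¹ := by
  rw [abs_le']
  constructor
  · exact ((Real.log_le_self (hδ.le.trans h)).trans h').trans (le_max_left _ _)
  · rw [← Real.log_inv]
    exact ((Real.log_le_self (inv_nonneg.mpr (hδ.le.trans h))).trans (inv_anti₀ hδ h)).trans
      (le_max_right _ _)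

section SectionMetric

variable {M : LineBundle X} {κ : Type*} [Fintype κ] {n : κ → ℕ} (s : ∀ k, M.PowSection (n k))

/-- The sum of the normalized absolute values `|s k| ^ (1 / n k)` of sections `s k` of `M ^ n k`,
in a local frame of `M`. -/
def sectionSize (w : AbsoluteValue C ℝ) (i : M.ι) (x : Pt p C) (hi : x.In (M.U i)) : ℝ :=
  ∑ k, w (x.eval hi ((s k).coeff i)) ^ (1 / (n k : ℝ))

variable {s}

theorem sectionSize_pos (hs : ∀ t : X, ∃ k, t ∈ (s k).locus) (i : M.ι) (x : Pt p C)
    (hi : x.In (M.U i)) :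
    0 < sectionSize s w i x hi := by
  obtain ⟨k, hk⟩ := hs (x.hom (IsLocalRing.closedPoint C))
  exact Finset.sum_pos' (fun _ _ => Real.rpow_nonneg (w.nonneg _) _) ⟨k, Finset.mem_univ k,
    Real.rpow_pos_of_pos (w.pos ((s k).eval_coeff_ne_zero x i hi (x.in_of_mem hk))) _⟩

theorem sectionSize_eq_mul (hn : ∀ k, 0 < n k) (i j : M.ι) (x : Pt p C) (hi : x.In (M.U i))
    (hj : x.In (M.U j)) :
    sectionSize s w i x hi = w (x.eval (hi.inf hj) (M.g i j).1) * sectionSize s w j x hj := by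
  rw [sectionSize, sectionSize, Finset.mul_sum]
  refine Finset.sum_congr rfl fun k _ => ?_
  rw [(s k).eval_coeff x i j hi hj, map_mul, map_pow,
    Real.mul_rpow (pow_nonneg (w.nonneg _) _) (w.nonneg _), ← Real.rpow_natCast _ (n k),
    ← Real.rpow_mul (w.nonneg _), mul_one_div_cancel (by have := hn k; positivity), Real.rpow_one]

theorem neg_log_sectionSize (hs : ∀ t : X, ∃ k, t ∈ (s k).locus) (hn : ∀ k, 0 < n k)
    (i j : M.ι) (x : Pt p C) (hi : x.In (M.U i)) (hj : x.In (M.U j)) :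
    -Real.log (sectionSize s w j x hj) =
      Real.log (w (x.eval (hi.inf hj) (M.g i j).1)) + -Real.log (sectionSize s w i x hi) := by
  have hpos : 0 < w (x.eval (hi.inf hj) (M.g i j).1) :=
    w.pos (x.eval_ne_zero_of_isUnit _ (M.g i j).isUnit)
  rw [sectionSize_eq_mul hn i j x hi hj,
    Real.log_mul hpos.ne' (sectionSize_pos hs j x hj).ne']
  ring

/-- The metric on `M` for which `∑ ‖s k‖ ^ (1 / n k) = 1`, given sections `s k` of `M ^ n k`
without common zeros. -/
def sectionMetric (hs : ∀ t : X, ∃ k, t ∈ (s k).locus) (p : X ⟶ Spec (.of K))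
    (w : AbsoluteValue C ℝ) (hn : ∀ k, 0 < n k) :
    LMetric p w M.toReal where
  logNorm i x hi := -Real.log (sectionSize s w i x hi)
  transition i j x hi hj hij := by
    exact (neg_log_sectionSize hs hn i j x hi hj).trans
      (congrArg (· + _) ((x.logAbs_tmul w hij 1 _).trans (one_mul _)).symm)

theorem sectionMetric_isAdmissible (hs : ∀ t : X, ∃ k, t ∈ (s k).locus) (p : X ⟶ Spec (.of K))
    (w : AbsoluteValue C ℝ) (hn : ∀ k, 0 < n k) : (sectionMetric hs p w hn).IsAdmissible := by
  constructor
  · intro i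
    let _ := ptTopology (p := p) w
    refine Continuous.neg (Continuous.log (continuous_finsetSum _ fun k _ => ?_) fun x =>
      (sectionSize_pos hs i x.1 x.2).ne')
    exact Continuous.rpow_const (contOn_eval ((s k).coeff i)) fun _ => Or.inr (by positivity)
  · intro (i : M.ι) V (hVi : V ≤ M.U i) hV E hE
    -- the `s k` generate the unit ideal of the affine open `V`, which bounds the sum from below
    let f : κ → Γ(X, V) := fun k => X.presheaf.map (homOfLE hVi).op ((s k).coeff i)
    have hspan : Ideal.span (Set.range f) = ⊤ := by
      rw [← hV.self_le_iSup_basicOpen_iff]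
      intro t ht
      obtain ⟨k, hk⟩ := hs t
      refine Opens.mem_iSup.mpr ⟨⟨f k, k, rfl⟩, ?_⟩
      change t ∈ X.basicOpen (X.presheaf.map (homOfLE hVi).op ((s k).coeff i))
      rw [Scheme.basicOpen_res]
      exact ⟨ht, (s k).inf_locus_le i ⟨hVi ht, hk⟩⟩
    obtain ⟨δ, hδ, hmin⟩ := hE.exists_le_of_span_eq_top f hspan
    obtain ⟨hin, hB⟩ := hE
    choose b hb using fun k => hB (f k)
    refine ⟨max (∑ k, |b k| ^ (1 / (n k : ℝ))) (min δ 1)⁻¹, fun x hx (hi : x.In (M.U i)) => ?_⟩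
    have heval : ∀ k, x.eval (hin x hx) (f k) = x.eval hi ((s k).coeff i) := fun k =>
      x.eval_res hVi _ _ _
    change |-Real.log (sectionSize s w i x hi)| ≤ _
    rw [abs_neg]
    refine abs_log_le_of_le_of_le (by positivity) ?_ (Finset.sum_le_sum fun k _ => ?_)
    · obtain ⟨k, hk⟩ := hmin x hx (hin x hx)
      rw [heval] at hk
      refine le_trans ?_ (Finset.single_le_sum
        (f := fun k => w (x.eval hi ((s k).coeff i)) ^ (1 / (n k : ℝ)))
        (fun _ _ => Real.rpow_nonneg (w.nonneg _) _) (Finset.mem_univ k))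
      -- the truncation at `1` makes the bound independent of the exponent `1 / n k ≤ 1`
      calc min δ 1 = min δ 1 ^ (1 : ℝ) := (Real.rpow_one _).symm
        _ ≤ min δ 1 ^ (1 / (n k : ℝ)) := by
          refine Real.rpow_le_rpow_of_exponent_ge (by positivity) (min_le_right _ _) ?_
          have : (1 : ℝ) ≤ n k := by exact_mod_cast hn k
          exact div_le_one_of_le₀ this (by positivity)
        _ ≤ _ := Real.rpow_le_rpow (by positivity) ((min_le_left _ _).trans hk) (by positivity)
    · rw [← heval]
      exact Real.rpow_le_rpow (w.nonneg _) ((hb k x hx).trans (le_abs_self _)) (by positivity)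

end SectionMetric

/-- Every ample real line bundle has a continuous and bounded metric. -/
theorem RLineBundle.IsAmple.exists_isAdmissible {L : RLineBundle X} (hL : L.IsAmple)
    (p : X ⟶ Spec (.of K)) (w : AbsoluteValue C ℝ) : ∃ N : LMetric p w L, N.IsAdmissible := by
  induction hL with
  | pow M hM r hr =>
    obtain ⟨κ, hκ, n, s, hn, -, hs⟩ := hM.exists_finite_sections
    have := Fintype.ofFinite κ
    exact ⟨_, (sectionMetric_isAdmissible hs p w hn).pow r⟩
  | tensor A B hA hB ihA ihB =>
    obtain ⟨N, hN⟩ := ihA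
    obtain ⟨N', hN'⟩ := ihB
    exact ⟨_, hN.tensor hN'⟩
  | iso A B e hA ih =>
    obtain ⟨N, hN⟩ := ih
    exact ⟨_, hN.ofIso e.symm⟩

/-- A scheme with an ample real line bundle has an ample line bundle. -/
theorem RLineBundle.IsAmple.exists_lineBundle {L : RLineBundle X} (hL : L.IsAmple) :
    ∃ M : LineBundle X, M.IsAmple := by
  induction hL with
  | pow M hM r hr => exact ⟨M, hM⟩
  | tensor A B hA hB ihA ihB => exact ihA
  | iso A B e hA ih => exact ih

end Metrics

/-! ### Canonical metrics -/

section Canonical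

variable {K : Type u} [Field K] {X : Scheme.{u}} {p : X ⟶ Spec (.of K)}
  {C : Type u} [Field C] [Algebra K C] {w : AbsoluteValue C ℝ} {L : RLineBundle X}

namespace LMetric

/-- The logarithm of the quotient of two metrics is bounded by `b` on all points. -/
def Close (N N' : LMetric p w L) (b : ℝ) : Prop :=
  ∀ (i : L.ι) (x : Pt p C) (hx : x.In (L.U i)), |N.logNorm i x hx - N'.logNorm i x hx| ≤ b

/-- The logarithm of the quotient of two metrics does not depend on the frame. -/
theorem logNorm_sub_logNorm (N N' : LMetric p w L) (i j : L.ι) (x : Pt p C) (hi : x.In (L.U i))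
    (hj : x.In (L.U j)) :
    N.logNorm i x hi - N'.logNorm i x hi = N.logNorm j x hj - N'.logNorm j x hj := by
  rw [N.transition i j x hi hj (hi.inf hj), N'.transition i j x hi hj (hi.inf hj)]
  ring

/-- On a proper scheme two bounded metrics have bounded quotient. -/
theorem exists_close [AlgebraicGeometry.IsIntegral X] [IsProper p] (hL : L.IsAmple)
    {N N' : LMetric p w L} (hN : N.IsBounded) (hN' : N'.IsBounded) : ∃ b, Close N N' b := by
  obtain ⟨M, hM⟩ := hL.exists_lineBundle
  obtain ⟨κ, hκ, V, E, hVE, hcov⟩ := hM.exists_bounded_cover (p := p) w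
  have := Fintype.ofFinite κ
  have h : ∀ a, ∃ b, ∀ x ∈ E a, ∀ (i : L.ι) (hx : x.In (L.U i)),
      |N.logNorm i x hx - N'.logNorm i x hx| ≤ b := by
    intro a
    refine (hVE a).2.exists_bound_of_local (hVE a).1
      (fun x b => ∀ (i : L.ι) (hx : x.In (L.U i)), |N.logNorm i x hx - N'.logNorm i x hx| ≤ b)
      (fun x b b' h hb i hx => (h i hx).trans hb) (Set.range L.U) (fun t _ => ?_) ?_
    · obtain ⟨j, hj⟩ := L.cover t
      exact ⟨_, ⟨j, rfl⟩, hj⟩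
    · rintro _ ⟨j, rfl⟩ D hD - hDU F - hF
      obtain ⟨b, hb⟩ := hN j D hDU hD F hF
      obtain ⟨b', hb'⟩ := hN' j D hDU hD F hF
      refine ⟨b + b', fun x hx i hi => ?_⟩
      have hj := (hF.choose x hx).mono hDU
      rw [logNorm_sub_logNorm N N' i j x hi hj]
      exact (abs_sub _ _).trans (add_le_add (hb x hx hj) (hb' x hx hj))
  choose b hb using h
  refine ⟨∑ a, |b a|, fun i x hi => ?_⟩
  obtain ⟨a, ha⟩ := hcov x
  exact ((hb a x ha i hi).trans (le_abs_self _)).trans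
    (Finset.single_le_sum (f := fun a => |b a|) (fun _ _ => abs_nonneg _) (Finset.mem_univ a))

section Iter

variable {r : ℝ} (hr : r ≠ 0) (f : X ⟶ X) (hf : f ≫ p = p)
  (Φ : RLineBundle.Iso (L.pow r) (L.pullback f))

theorem iter_logNorm (N : LMetric p w L) (i j : L.ι) (x : Pt p C) (hi : x.In (L.U i))
    (hj : (x.map f hf).In (L.U j)) (hij : x.In (L.U i ⊓ f ⁻¹ᵁ L.U j)) :
    (iter hr f hf Φ N).logNorm i x hi =
      (x.logAbs w hij (Φ.h i j) + N.logNorm j (x.map f hf) hj) / r :=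
  congrArg (· / r) (ofIso_logNorm Φ (pullback f hf N) i j x hi hj)

/-- The operator `‖·‖ ↦ (Φ^* f^* ‖·‖) ^ (1 / r)` is a contraction for `r > 1`. -/
theorem Close.iter (hr' : 0 < r) {N N' : LMetric p w L} {b : ℝ} (h : Close N N' b) :
    Close (iter hr f hf Φ N) (LMetric.iter hr f hf Φ N') (b / r) := by
  intro i x hi
  obtain ⟨j, hj⟩ := (x.map f hf).exists_in L.U L.cover
  have hij : x.In (L.U i ⊓ f ⁻¹ᵁ L.U j) := fun t ht => ⟨hi ht, hj ht⟩
  rw [iter_logNorm hr f hf Φ N i j x hi hj hij, iter_logNorm hr f hf Φ N' i j x hi hj hij,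
    ← sub_div, add_sub_add_left_eq_sub, abs_div, abs_of_pos hr']
  exact div_le_div_of_nonneg_right (h j _ hj) hr'.le

theorem Close.iterate (hr' : 0 < r) {N N' : LMetric p w L} {b : ℝ} (h : Close N N' b) (n : ℕ) :
    Close ((LMetric.iter hr f hf Φ)^[n] N) ((LMetric.iter hr f hf Φ)^[n] N') (b / r ^ n) := by
  induction n with
  | zero => simpa using h
  | succ n ih =>
    rw [Function.iterate_succ_apply', Function.iterate_succ_apply', pow_succ, ← div_div]
    exact ih.iter hr f hf Φ hr'

theorem IsAdmissible.iterate {N : LMetric p w L} (hN : N.IsAdmissible) (n : ℕ) :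
    ((LMetric.iter hr f hf Φ)^[n] N).IsAdmissible := by
  induction n with
  | zero => exact hN
  | succ n ih =>
    rw [Function.iterate_succ_apply']
    exact ih.iter hr f hf Φ

theorem UnifTendsto.unique {F : ℕ → LMetric p w L} {N N' : LMetric p w L}
    (h : UnifTendsto F N) (h' : UnifTendsto F N') : N = N' := by
  ext i x hx
  have key : ∀ {N : LMetric p w L}, UnifTendsto F N →
      Filter.Tendsto (fun n => (F n).logNorm i x hx) Filter.atTop (nhds (N.logNorm i x hx)) :=
    fun h => Metric.tendsto_atTop.mpr fun ε hε => (h ε hε).imp fun _ hn n hnn => hn n hnn i x hx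
  exact tendsto_nhds_unique (key h) (key h')

theorem IsCanonical.isAdmissible {N : LMetric p w L} (h : IsCanonical hr f hf Φ N) :
    N.IsAdmissible :=
  ⟨h.1, h.2.1⟩

theorem IsCanonical.unifTendsto {N N₁ : LMetric p w L} (h : IsCanonical hr f hf Φ N)
    (hN₁ : N₁.IsAdmissible) : UnifTendsto (fun n => (LMetric.iter hr f hf Φ)^[n] N₁) N :=
  h.2.2 N₁ hN₁.1 hN₁.2

theorem IsCanonical.unique {N N' : LMetric p w L} (h : IsCanonical hr f hf Φ N)
    (h' : IsCanonical hr f hf Φ N') : N = N' :=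
  (h.unifTendsto hr f hf Φ h.isAdmissible).unique (h'.unifTendsto hr f hf Φ h.isAdmissible)

/-- A continuous and bounded fixed point is the limit of its own iterates, so it is canonical. -/
theorem IsCanonical.eq_of_iter_eq {N N' : LMetric p w L} (h : IsCanonical hr f hf Φ N)
    (hN' : N'.IsAdmissible) (hfix : LMetric.iter hr f hf Φ N' = N') : N' = N := by
  refine UnifTendsto.unique (fun ε hε => ⟨0, fun n _ i x hx => ?_⟩)
    (h.unifTendsto hr f hf Φ hN')
  have hn : (LMetric.iter hr f hf Φ)^[n] N' = N' := Function.iterate_fixed hfix n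
  change |((LMetric.iter hr f hf Φ)^[n] N').logNorm i x hx - _| < ε
  rw [hn, sub_self, abs_zero]
  exact hε

theorem IsCanonical.iter_eq (hr' : 1 < r) {N : LMetric p w L} (h : IsCanonical hr f hf Φ N) :
    LMetric.iter hr f hf Φ N = N := by
  have hr0 : 0 < r := zero_lt_one.trans hr'
  refine UnifTendsto.unique (F := fun n => (LMetric.iter hr f hf Φ)^[n + 1] N) ?_ ?_
  · intro ε hε
    obtain ⟨n₀, hn₀⟩ := h.unifTendsto hr f hf Φ h.isAdmissible ε hε
    refine ⟨n₀, fun n hn i x hx => ?_⟩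
    beta_reduce
    rw [Function.iterate_succ_apply']
    have hc : Close ((LMetric.iter hr f hf Φ)^[n] N) N ε := fun i x hx => (hn₀ n hn i x hx).le
    exact ((hc.iter hr f hf Φ hr0) i x hx).trans_lt (div_lt_self hε hr')
  · intro ε hε
    obtain ⟨n₀, hn₀⟩ := h.unifTendsto hr f hf Φ h.isAdmissible ε hε
    exact ⟨n₀, fun n hn => hn₀ (n + 1) (by omega)⟩

/-- Tate's limit argument: starting from any continuous and bounded metric, the iterates form a
uniform Cauchy sequence, whose limit does not depend on the starting point. -/
theorem exists_isCanonical [AlgebraicGeometry.IsIntegral X] [IsProper p] (hL : L.IsAmple)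
    (hr' : 1 < r) : ∃ N : LMetric p w L, IsCanonical hr f hf Φ N := by
  have hr0 : 0 < r := zero_lt_one.trans hr'
  have hrinv : r⁻¹ < 1 := inv_lt_one_of_one_lt₀ hr'
  obtain ⟨N₀, hN₀⟩ := hL.exists_isAdmissible p w
  let T := LMetric.iter (w := w) hr f hf Φ
  -- consecutive iterates are at distance at most `b / r ^ n`
  obtain ⟨b, hb⟩ := exists_close hL (hN₀.iter hr f hf Φ).2 hN₀.2
  let u : ∀ (i : L.ι) (x : Pt p C), x.In (L.U i) → ℕ → ℝ := fun i x hx n =>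
    (T^[n] N₀).logNorm i x hx
  have hu : ∀ i x hx n, dist (u i x hx n) (u i x hx (n + 1)) ≤ b * r⁻¹ ^ n := fun i x hx n => by
    have h := hb.iterate hr f hf Φ hr0 n i x hx
    rw [← Function.iterate_succ_apply, ← Real.dist_eq, dist_comm] at h
    rwa [inv_pow, ← div_eq_mul_inv]
  choose l hl using fun i x hx =>
    cauchySeq_tendsto_of_complete (cauchySeq_of_le_geometric r⁻¹ b hrinv (hu i x hx))
  let N : LMetric p w L :=
    { logNorm := l
      transition := fun i j x hi hj hij => by
        refine tendsto_nhds_unique (hl j x hj) ?_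
        have h : u j x hj = fun n => x.logAbs w hij (L.g i j) + u i x hi n :=
          funext fun n => (T^[n] N₀).transition i j x hi hj hij
        rw [h]
        exact (hl i x hi).const_add _ }
  have hclose : ∀ n, Close (T^[n] N₀) N (b * r⁻¹ ^ n / (1 - r⁻¹)) := fun n i x hx =>
    dist_le_of_le_geometric_of_tendsto r⁻¹ b hrinv (hu i x hx) (hl i x hx) n
  have hlim : ∀ b' : ℝ, ∀ ε > 0, ∃ n₀ : ℕ, ∀ n ≥ n₀, b' * r⁻¹ ^ n < ε := fun b' ε hε => by
    have h := (tendsto_pow_atTop_nhds_zero_of_lt_one (by positivity) hrinv).const_mul b'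
    rw [mul_zero] at h
    exact Filter.eventually_atTop.mp (h.eventually_lt_const hε)
  have hunif : UnifTendsto (fun n => T^[n] N₀) N := fun ε hε => by
    obtain ⟨n₀, hn₀⟩ := hlim (b / (1 - r⁻¹)) ε hε
    refine ⟨n₀, fun n hn i x hx => (hclose n i x hx).trans_lt ?_⟩
    rw [mul_div_right_comm]
    exact hn₀ n hn
  refine ⟨N, fun i => ?_, fun i V hVi hV E hE => ?_, fun N₁ hN₁c hN₁b => ?_⟩
  · refine contOn_of_uniform_limit (G := fun x hx => N.logNorm i x hx)
      (fun n => (T^[n] N₀).logNorm i) (fun n => (hN₀.iterate hr f hf Φ n).1.contOn i)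
      fun ε hε => ?_
    obtain ⟨n, hn⟩ := hunif ε hε
    exact ⟨n, hn n le_rfl i⟩
  · obtain ⟨b', hb'⟩ := hN₀.2 i V hVi hV E hE
    refine ⟨b * r⁻¹ ^ 0 / (1 - r⁻¹) + b', fun x hx hi => ?_⟩
    have h1 := hclose 0 i x hi
    have h2 := hb' x hx hi
    rw [abs_sub_comm] at h1
    calc |N.logNorm i x hi| = |(N.logNorm i x hi - N₀.logNorm i x hi) + N₀.logNorm i x hi| := by
          rw [sub_add_cancel]
      _ ≤ _ := (abs_add_le _ _).trans (add_le_add h1 h2)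
  · obtain ⟨b', hb'⟩ := exists_close hL hN₁b hN₀.2
    intro ε hε
    obtain ⟨n₀, hn₀⟩ := hlim b' (ε / 2) (half_pos hε)
    obtain ⟨n₁, hn₁⟩ := hunif (ε / 2) (half_pos hε)
    refine ⟨max n₀ n₁, fun n hn i x hx => ?_⟩
    have h1 := hb'.iterate hr f hf Φ hr0 n i x hx
    have h2 := hn₁ n ((le_max_right _ _).trans hn) i x hx
    have h3 := hn₀ n ((le_max_left _ _).trans hn)
    rw [inv_pow, ← div_eq_mul_inv] at h3
    exact (abs_sub_le _ ((T^[n] N₀).logNorm i x hx) _).trans_lt (by linarith)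

end Iter

end LMetric

/-! ### Commuting polarized systems -/

variable {φ ψ : X ⟶ X} {α β : ℝ}

/-- Compatibility of `Φ` and `Ψ` makes the two operators on metrics commute. -/
theorem Compatible.iter_comm (hφ : φ ≫ p = p) (hψ : ψ ≫ p = p) (hα : α ≠ 0) (hβ : β ≠ 0)
    {Φ : RLineBundle.Iso (L.pow α) (L.pullback φ)} {Ψ : RLineBundle.Iso (L.pow β) (L.pullback ψ)}
    (hcomm : ψ ≫ φ = φ ≫ ψ) (h : Compatible Φ Ψ) (N : LMetric p w L) :
    LMetric.iter hβ ψ hψ Ψ (LMetric.iter hα φ hφ Φ N) =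
      LMetric.iter hα φ hφ Φ (LMetric.iter hβ ψ hψ Ψ N) := by
  ext i x hi
  obtain ⟨j, hj⟩ := (x.map ψ hψ).exists_in L.U L.cover
  obtain ⟨k, hk⟩ := (x.map φ hφ).exists_in L.U L.cover
  obtain ⟨l, hl⟩ := ((x.map ψ hψ).map φ hφ).exists_in L.U L.cover
  have hxx : (x.map ψ hψ).map φ hφ = (x.map φ hφ).map ψ hψ := by
    simp only [Pt.map, Category.assoc, hcomm]
  have hl' : ((x.map φ hφ).map ψ hψ).In (L.U l) := hxx ▸ hl
  have hij : x.In (L.U i ⊓ ψ ⁻¹ᵁ L.U j) := fun t ht => ⟨hi ht, hj ht⟩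
  have hik : x.In (L.U i ⊓ φ ⁻¹ᵁ L.U k) := fun t ht => ⟨hi ht, hk ht⟩
  have hjl : (x.map ψ hψ).In (L.U j ⊓ φ ⁻¹ᵁ L.U l) := fun t ht => ⟨hj ht, hl ht⟩
  have hkl : (x.map φ hφ).In (L.U k ⊓ ψ ⁻¹ᵁ L.U l) := fun t ht => ⟨hk ht, hl' ht⟩
  rw [LMetric.iter_logNorm hβ ψ hψ Ψ _ i j x hi hj hij,
    LMetric.iter_logNorm hα φ hφ Φ _ j l _ hj hl hjl,
    LMetric.iter_logNorm hα φ hφ Φ _ i k x hi hk hik,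
    LMetric.iter_logNorm hβ ψ hψ Ψ _ k l _ hk hl' hkl]
  have hW : x.In ((L.U i ⊓ ψ ⁻¹ᵁ L.U j ⊓ ψ ⁻¹ᵁ (L.U j ⊓ φ ⁻¹ᵁ L.U l)) ⊓
      (L.U i ⊓ φ ⁻¹ᵁ L.U k ⊓ φ ⁻¹ᵁ (L.U k ⊓ ψ ⁻¹ᵁ L.U l))) :=
    fun t ht => ⟨⟨hij ht, hjl ht⟩, hik ht, hkl ht⟩
  have hc := congrArg (x.logAbs w hW) (h i j k l _ (inf_le_left.trans inf_le_left)
    (inf_le_left.trans inf_le_right) (inf_le_right.trans inf_le_left)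
    (inf_le_right.trans inf_le_right))
  rw [map_add, map_add, map_smul, map_smul, x.logAbs_res w _ hW hij, x.logAbs_res w _ hW hik,
    x.logAbs_pull w ψ hψ _ hW hjl, x.logAbs_pull w φ hφ _ hW hkl, smul_eq_mul, smul_eq_mul] at hc
  have hN : ∀ (y y' : Pt p C) (e : y = y') (hy : y.In (L.U l)) (hy' : y'.In (L.U l)),
      N.logNorm l y hy = N.logNorm l y' hy' := by
    rintro y _ rfl _ _; rfl
  rw [hN _ _ hxx hl hl']
  field_simp
  linarith

/-- The isomorphism `c Ψ`, for a global unit `c` with real exponents. -/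
def RLineBundle.Iso.shift {A B : RLineBundle X} (e : RLineBundle.Iso A B) (c : RUnits X ⊤) :
    RLineBundle.Iso A B where
  h i j := e.h i j + RUnits.res le_top c
  compat i i' j j' W hA hij hij' hB := by
    rw [map_add, map_add, RUnits.res_res, RUnits.res_res, ← add_assoc, e.compat _ _ _ _ W hA hij
      hij' hB]
    abel

/-- If `c` solves `β c - ψ^* c = a`, multiplying `Ψ` by `a` and the metric by `c` multiplies the
result of the operator by `c`. -/
theorem LMetric.iter_shift_shift (hψ : ψ ≫ p = p) (hβ : β ≠ 0)
    (Ψ : RLineBundle.Iso (L.pow β) (L.pullback ψ)) (N : LMetric p w L) (a c : RUnits X ⊤)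
    (hac : β • c - RUnits.pull ψ (ψ.preimage_top.ge : (⊤ : X.Opens) ≤ ψ ⁻¹ᵁ ⊤) c = a) :
    LMetric.iter hβ ψ hψ (Ψ.shift a) (N.shift c) = (LMetric.iter hβ ψ hψ Ψ N).shift c := by
  ext i x hi
  obtain ⟨j, hj⟩ := (x.map ψ hψ).exists_in L.U L.cover
  have hij : x.In (L.U i ⊓ ψ ⁻¹ᵁ L.U j) := fun t ht => ⟨hi ht, hj ht⟩
  rw [LMetric.iter_logNorm hβ ψ hψ _ _ i j x hi hj hij]
  change (x.logAbs w hij (Ψ.h i j + RUnits.res le_top a) +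
    ((x.map ψ hψ).logAbs w (Pt.in_top _) c + N.logNorm j _ hj)) / β =
      x.logAbs w x.in_top c + (LMetric.iter hβ ψ hψ Ψ N).logNorm i x hi
  have h := congrArg (x.logAbs w x.in_top) hac
  rw [map_sub, map_smul, smul_eq_mul, x.logAbs_pull w ψ hψ _ _ (Pt.in_top _)] at h
  rw [LMetric.iter_logNorm hβ ψ hψ _ _ i j x hi hj hij, map_add,
    x.logAbs_res w _ hij x.in_top, ← h]
  field_simp
  ring

theorem RUnits.pull_pull {X Y Z : Scheme.{u}} (f : Z ⟶ Y) (g : Y ⟶ X) {U : X.Opens} {V : Y.Opens}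
    {W : Z.Opens} (e : V ≤ g ⁻¹ᵁ U) (e' : W ≤ f ⁻¹ᵁ V) (e'' : W ≤ (f ≫ g) ⁻¹ᵁ U)
    (a : RUnits X U) : RUnits.pull f e' (RUnits.pull g e a) = RUnits.pull (f ≫ g) e'' a := by
  unfold RUnits.pull
  rw [RUnits.ofHom_comp, Scheme.Hom.appLE_comp_appLE]

theorem RUnits.pull_congr {X Y : Scheme.{u}} {f g : Y ⟶ X} (h : f = g) {U : X.Opens}
    {V : Y.Opens} (e : V ≤ f ⁻¹ᵁ U) (e' : V ≤ g ⁻¹ᵁ U) (a : RUnits X U) :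
    RUnits.pull f e a = RUnits.pull g e' a := by
  subst h
  rfl

theorem RLineBundle.Iso.compat_pull {X Y : Scheme.{u}} {A B : RLineBundle X}
    (e : RLineBundle.Iso A B) (f : Y ⟶ X) (i i' : A.ι) (j j' : B.ι) {W : Y.Opens}
    (hA : W ≤ f ⁻¹ᵁ (A.U i ⊓ A.U i')) (hij : W ≤ f ⁻¹ᵁ (A.U i ⊓ B.U j))
    (hij' : W ≤ f ⁻¹ᵁ (A.U i' ⊓ B.U j')) (hB : W ≤ f ⁻¹ᵁ (B.U j ⊓ B.U j')) :
    RUnits.pull f hA (A.g i i') + RUnits.pull f hij (e.h i j) =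
      RUnits.pull f hij' (e.h i' j') + RUnits.pull f hB (B.g j j') := by
  have hW : W ≤ f ⁻¹ᵁ ((A.U i ⊓ B.U j) ⊓ (A.U i' ⊓ B.U j')) := fun t ht => ⟨hij ht, hij' ht⟩
  have h := congrArg (RUnits.pull f hW) (e.compat i i' j j' _
    (inf_le_inf inf_le_left inf_le_left) inf_le_left inf_le_right
    (inf_le_inf inf_le_right inf_le_right))
  rwa [map_add, map_add, RUnits.pull_res f _ hW hA, RUnits.pull_res f _ hW hij,
    RUnits.pull_res f _ hW hij', RUnits.pull_res f _ hW hB] at h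

/-- For commuting `φ` and `ψ`, the isomorphism `Ψ` can be multiplied by a global unit so that it
becomes compatible with `Φ`. The two isomorphisms `L ^ (α β) ≅ (φ ψ)^* L` differ by a global
unit `c`, and replacing `Ψ` by `u Ψ` changes `c` by `α u - φ^* u`. -/
theorem exists_compatible_shift (p : X ⟶ Spec (.of K)) [AlgebraicGeometry.IsIntegral X]
    [IsProper p] (hφ : φ ≫ p = p) (hα : 1 < α)
    (Φ : RLineBundle.Iso (L.pow α) (L.pullback φ)) (Ψ : RLineBundle.Iso (L.pow β) (L.pullback ψ))
    (hcomm : ψ ≫ φ = φ ≫ ψ) : ∃ u : RUnits X ⊤, Compatible Φ (Ψ.shift u) := by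
  have : CompactSpace X := (quasiCompact_iff_compactSpace p).mp inferInstance
  let I := L.ι × L.ι × L.ι × L.ι
  let A : I → X.Opens := fun a => L.U a.1 ⊓ ψ ⁻¹ᵁ L.U a.2.1
  let B : I → X.Opens := fun a => ψ ⁻¹ᵁ (L.U a.2.1 ⊓ φ ⁻¹ᵁ L.U a.2.2.2)
  let A' : I → X.Opens := fun a => L.U a.1 ⊓ φ ⁻¹ᵁ L.U a.2.2.1
  let B' : I → X.Opens := fun a => φ ⁻¹ᵁ (L.U a.2.2.1 ⊓ ψ ⁻¹ᵁ L.U a.2.2.2)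
  -- the difference of the two isomorphisms, in the frames `a = (i, j, k, l)`
  let θ : ∀ (a : I) (W : X.Opens), W ≤ A a → W ≤ B a → W ≤ A' a → W ≤ B' a → RUnits X W :=
    fun a W h₁ h₂ h₃ h₄ =>
      (α • RUnits.res h₁ (Ψ.h a.1 a.2.1) + RUnits.pull ψ h₂ (Φ.h a.2.1 a.2.2.2)) -
        (β • RUnits.res h₃ (Φ.h a.1 a.2.2.1) + RUnits.pull φ h₄ (Ψ.h a.2.2.1 a.2.2.2))
  have hθres : ∀ a W W' (e : W' ≤ W) h₁ h₂ h₃ h₄, RUnits.res e (θ a W h₁ h₂ h₃ h₄) =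
      θ a W' (e.trans h₁) (e.trans h₂) (e.trans h₃) (e.trans h₄) := by
    intro a W W' e h₁ h₂ h₃ h₄
    simp only [θ, map_sub, map_add, map_smul, RUnits.res_res, RUnits.res_pull]
  -- it is independent of the frames: all transition functions cancel
  have hθ : ∀ a a' W h₁ h₂ h₃ h₄ h₁' h₂' h₃' h₄',
      θ a W h₁ h₂ h₃ h₄ = θ a' W h₁' h₂' h₃' h₄' := by
    rintro ⟨i, j, k, l⟩ ⟨i', j', k', l'⟩ W h₁ h₂ h₃ h₄ h₁' h₂' h₃' h₄'
    have e₁ := Ψ.compat i i' j j' W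
      (le_inf (h₁.trans inf_le_left) (h₁'.trans inf_le_left)) h₁ h₁'
      (le_inf (h₁.trans inf_le_right) (h₁'.trans inf_le_right))
    have hB₂ : W ≤ ψ ⁻¹ᵁ ((L.pullback φ).U l ⊓ (L.pullback φ).U l') :=
      fun t ht => ⟨(h₂ ht).2, (h₂' ht).2⟩
    have hB₄ : W ≤ φ ⁻¹ᵁ ((L.pullback ψ).U l ⊓ (L.pullback ψ).U l') :=
      fun t ht => ⟨(h₄ ht).2, (h₄' ht).2⟩
    have e₂ := Φ.compat_pull ψ j j' l l' (W := W) (fun t ht => ⟨(h₂ ht).1, (h₂' ht).1⟩) h₂ h₂' hB₂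
    have e₃ := Φ.compat i i' k k' W
      (le_inf (h₃.trans inf_le_left) (h₃'.trans inf_le_left)) h₃ h₃'
      (le_inf (h₃.trans inf_le_right) (h₃'.trans inf_le_right))
    have e₄ := Ψ.compat_pull φ k k' l l' (W := W) (fun t ht => ⟨(h₄ ht).1, (h₄' ht).1⟩) h₄ h₄' hB₄
    have hl : W ≤ (ψ ≫ φ) ⁻¹ᵁ (L.U l ⊓ L.U l') := fun t ht => ⟨(h₂ ht).2, (h₂' ht).2⟩
    have hl' : W ≤ (φ ≫ ψ) ⁻¹ᵁ (L.U l ⊓ L.U l') := fun t ht => ⟨(h₄ ht).2, (h₄' ht).2⟩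
    rw [map_smul, RUnits.res_pull] at e₁ e₃
    rw [map_smul] at e₂ e₄
    have hz : RUnits.pull ψ hB₂ ((L.pullback φ).g l l') =
        RUnits.pull φ hB₄ ((L.pullback ψ).g l l') :=
      (RUnits.pull_pull ψ φ _ hB₂ hl _).trans ((RUnits.pull_congr hcomm hl hl' _).trans
        (RUnits.pull_pull φ ψ _ hB₄ hl' _).symm)
    rw [hz] at e₂
    change (α • RUnits.res h₁ (Ψ.h i j) + RUnits.pull ψ h₂ (Φ.h j l)) -
        (β • RUnits.res h₃ (Φ.h i k) + RUnits.pull φ h₄ (Ψ.h k l)) =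
      (α • RUnits.res h₁' (Ψ.h i' j') + RUnits.pull ψ h₂' (Φ.h j' l')) -
        (β • RUnits.res h₃' (Φ.h i' k') + RUnits.pull φ h₄' (Ψ.h k' l'))
    linear_combination (norm := skip) α • e₁ + e₂ - β • e₃ - e₄
    simp only [smul_add, smul_comm β α]
    abel
  let V : I → X.Opens := fun a => A a ⊓ B a ⊓ (A' a ⊓ B' a)
  have hVA : ∀ a, V a ≤ A a := fun a => inf_le_left.trans inf_le_left
  have hVB : ∀ a, V a ≤ B a := fun a => inf_le_left.trans inf_le_right
  have hVA' : ∀ a, V a ≤ A' a := fun a => inf_le_right.trans inf_le_left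
  have hVB' : ∀ a, V a ≤ B' a := fun a => inf_le_right.trans inf_le_right
  have hcover : ∀ t : X, ∃ a, t ∈ V a := by
    intro t
    obtain ⟨i, hi⟩ := L.cover t
    obtain ⟨j, hj⟩ := L.cover (ψ t)
    obtain ⟨k, hk⟩ := L.cover (φ t)
    obtain ⟨l, hl⟩ := L.cover (φ (ψ t))
    have hl' : ψ (φ t) ∈ L.U l := by
      have h := congrArg (fun f : X ⟶ X => f t) hcomm
      simp only [Scheme.Hom.comp_apply] at h
      exact h ▸ hl
    exact ⟨(i, j, k, l), ⟨⟨hi, hj⟩, hj, hl⟩, ⟨hi, hk⟩, hk, hl'⟩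
  obtain ⟨c, hc⟩ := RUnits.exists_glue V hcover
    (fun a => θ a (V a) (hVA a) (hVB a) (hVA' a) (hVB' a))
    (fun a b => by rw [hθres, hθres]; exact hθ _ _ _ _ _ _ _ _ _ _ _)
  obtain ⟨u, hu⟩ := RUnits.exists_smul_sub_pull_eq p φ hφ hα (-c)
  refine ⟨u, fun i j k l W h₁ h₂ h₃ h₄ => ?_⟩
  have hWV : W ≤ V (i, j, k, l) := le_inf (le_inf h₁ h₂) (le_inf h₃ h₄)
  have h1 := congrArg (RUnits.res hWV) (hc (i, j, k, l))
  rw [hθres, RUnits.res_res] at h1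
  have h2 := congrArg (RUnits.res (le_top : W ≤ ⊤)) hu
  rw [map_sub, map_smul, RUnits.res_pull, map_neg, h1] at h2
  change α • RUnits.res h₁ (Ψ.h i j + RUnits.res le_top u) + RUnits.pull ψ h₂ (Φ.h j l) =
      β • RUnits.res h₃ (Φ.h i k) + RUnits.pull φ h₄ (Ψ.h k l + RUnits.res le_top u)
  rw [map_add, map_add, smul_add, RUnits.res_res,
    RUnits.pull_res φ le_top h₄ (le_top.trans φ.preimage_top.ge)]
  have h3 : α • RUnits.res (le_top : W ≤ ⊤) u -
      RUnits.pull φ (le_top.trans φ.preimage_top.ge) u =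
      -((α • RUnits.res h₁ (Ψ.h i j) + RUnits.pull ψ h₂ (Φ.h j l)) -
        (β • RUnits.res h₃ (Φ.h i k) + RUnits.pull φ h₄ (Ψ.h k l))) := h2
  rw [← sub_eq_zero] at h3 ⊢
  rw [← h3]
  abel

end Canonical

end PolDyn

end

theorem mainTheorem1 {K : Type u} [Field K] [NumberField K]
    {X : Scheme.{u}} (p : X ⟶ Spec (.of K)) [IsIntegral X] [IsProper p]
    (L : PolDyn.RLineBundle X) (hL : L.IsAmple)
    (φ ψ : X ⟶ X) (hφ : φ ≫ p = p) (hψ : ψ ≫ p = p)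
    (α β : ℝ) (hα : 1 < α) (hβ : 1 < β)
    (Φ : PolDyn.RLineBundle.Iso (L.pow α) (L.pullback φ))
    (Ψ : PolDyn.RLineBundle.Iso (L.pow β) (L.pullback ψ))
    (hcomm : ψ ≫ φ = φ ≫ ψ) :
    -- at every place the canonical metrics exist and are unique
    (∀ v : PolDyn.Place K,
      (∃! N : PolDyn.LMetric p v.abs L,
        N.IsCanonical (zero_lt_one.trans hα).ne' φ hφ Φ) ∧
      (∃! N : PolDyn.LMetric p v.abs L,
        N.IsCanonical (zero_lt_one.trans hβ).ne' ψ hψ Ψ)) ∧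
    -- for compatible isomorphisms they are equal at every place
    (PolDyn.Compatible Φ Ψ → ∀ (v : PolDyn.Place K) (Nφ Nψ : PolDyn.LMetric p v.abs L),
      Nφ.IsCanonical (zero_lt_one.trans hα).ne' φ hφ Φ →
      Nψ.IsCanonical (zero_lt_one.trans hβ).ne' ψ hψ Ψ → Nφ = Nψ) ∧
    -- compatible isomorphisms can be chosen
    (∃ Ψ' : PolDyn.RLineBundle.Iso (L.pow β) (L.pullback ψ), PolDyn.Compatible Φ Ψ') ∧
    -- for arbitrary isomorphisms they agree up to one global unit, the same for all places
    (∃ c : PolDyn.RUnits X ⊤, ∀ (v : PolDyn.Place K) (Nφ Nψ : PolDyn.LMetric p v.abs L),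
      Nφ.IsCanonical (zero_lt_one.trans hα).ne' φ hφ Φ →
      Nψ.IsCanonical (zero_lt_one.trans hβ).ne' ψ hψ Ψ →
      ∀ (i : L.ι) (x : PolDyn.Pt p v.Cl) (hx : x.In (L.U i)) (hx' : x.In ⊤),
        Nψ.logNorm i x hx = x.logAbs v.abs hx' c + Nφ.logNorm i x hx) := by
  have hα0 : α ≠ 0 := (zero_lt_one.trans hα).ne'
  have hβ0 : β ≠ 0 := (zero_lt_one.trans hβ).ne'
  -- commuting operators: the canonical metric of `φ` is fixed by the operator of `ψ`
  have hcompat : ∀ (Ψ : PolDyn.RLineBundle.Iso (L.pow β) (L.pullback ψ)),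
      PolDyn.Compatible Φ Ψ → ∀ (v : PolDyn.Place K) (N : PolDyn.LMetric p v.abs L),
      N.IsCanonical hα0 φ hφ Φ → PolDyn.LMetric.iter hβ0 ψ hψ Ψ N = N := by
    intro Ψ h v N hN
    refine hN.eq_of_iter_eq hα0 φ hφ Φ (hN.isAdmissible.iter hβ0 ψ hψ Ψ) ?_
    rw [← h.iter_comm hφ hψ hα0 hβ0 hcomm, hN.iter_eq hα0 φ hφ Φ hα]
  obtain ⟨a, ha⟩ := PolDyn.exists_compatible_shift p hφ hα Φ Ψ hcomm
  refine ⟨fun v => ⟨?_, ?_⟩, ?_, ⟨_, ha⟩, ?_⟩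
  · obtain ⟨N, hN⟩ := PolDyn.LMetric.exists_isCanonical (w := v.abs) hα0 φ hφ Φ hL hα
    exact ⟨N, hN, fun N' hN' => hN'.unique hα0 φ hφ Φ hN⟩
  · obtain ⟨N, hN⟩ := PolDyn.LMetric.exists_isCanonical (w := v.abs) hβ0 ψ hψ Ψ hL hβ
    exact ⟨N, hN, fun N' hN' => hN'.unique hβ0 ψ hψ Ψ hN⟩
  · intro h v Nφ Nψ hNφ hNψ
    exact hNψ.eq_of_iter_eq hβ0 ψ hψ Ψ hNφ.isAdmissible (hcompat Ψ h v Nφ hNφ)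
  -- `Ψ` is the compatible isomorphism `Ψ.shift a` shifted by `-a`, so `c` must solve `β c - ψ^* c = -a`
  · obtain ⟨c, hc⟩ := PolDyn.RUnits.exists_smul_sub_pull_eq p ψ hψ hβ (-a)
    refine ⟨c, fun v Nφ Nψ hNφ hNψ i x hx hx' => ?_⟩
    have hΨ : (Ψ.shift a).shift (-a) = Ψ := by
      cases Ψ
      simp [PolDyn.RLineBundle.Iso.shift]
    have hfix : PolDyn.LMetric.iter hβ0 ψ hψ Ψ (Nφ.shift c) = Nφ.shift c := by
      have h := Nφ.iter_shift_shift hψ hβ0 (Ψ.shift a) (-a) c hc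
      rwa [hΨ, hcompat _ ha v Nφ hNφ] at h
    rw [← hNψ.eq_of_iter_eq hβ0 ψ hψ Ψ (hNφ.isAdmissible.shift c) hfix]
    rfl
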